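/- \textbf{Setting.} Let $\mu\in\mathbb R$, $\sigma\neq0$, $r>0$, and let $m<0<n$ be the roots of $\tfrac12\sigma^2k^2+(\mu-\tfrac12\sigma^2)k-r=0$. Assume $m+1<0$ and $m+n+1\ge 0$ (equivalently, $\sigma^2<r+\mu$ and $\sigma^2\ge\mu$). Put $$F(s)=1-e^{-s},\quad R(x,s)=\bigl(x^{-1}F(s)-1\bigr)^+,\quad G_\infty=\frac{(m+1)(n+1)}{mn}\in\,]0,1],\quad G(s)=G_\infty F(s),\quad H_\infty^\circ=\frac{m+1}{m}\in\,]0,G_\infty[ .$$ Fix $H_\infty\in\,]0,G_\infty]$ and let $H:\,]0,\infty[\,\to\mathbb R$ be a solution to $$\dot H(s)=\frac{\dot F(s)\Bigl((n+1)\bigl(H(s)/s\bigr)^{n-m}-(m+1)\Bigr)H(s)}{-mn\,\bigl(G(s)-H(s)\bigr)\Bigl(1-\bigl(H(s)/s\bigr)^{n-m}\Bigr)},\qquad s>0,$$ such that $0<H(s)<G(s)$ and $\dot H(s)>0$ for all $s>0$, $\lim_{s\downarrow0}H(s)=0$ and $\lim_{s\uparrow\infty}H(s)=H_\infty$. Define,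 for $0<x\le s$, $$w(x,s)=\begin{cases}x^{-1}F(s)-1,&x\le H(s),\\ A(s)x^n+B(s)x^m,&x>H(s),\end{cases}\qquad A=\frac{mH-(m+1)F}{(n-m)H^{n+1}},\quad B=\frac{(n+1)F-nH}{(n-m)H^{m+1}} .$$ Given a filtered probability space satisfying the usual conditions and carrying a standard one-dimensional Brownian motion $W$ relative to its filtration, and given $0<x\le s$, let $X_t=x\exp\bigl((\mu-\tfrac12\sigma^2)t+\sigma W_t\bigr)$ (the solution to $dX_t=\mu X_t\,dt+\sigma X_t\,dW_t$, $X_0=x$) and $S_t=\max\{s,\max_{0\le u\le t}X_u\}$. Consider, for $0<x\le s$, the variational inequality $$\max\Bigl\{\tfrac12\sigma^2x^2w_{xx}(x,s)+\mu xw_x(x,s)-rw(x,s),\;R(x,s)-w(x,s)\Bigr\}=0, \tag{VI}$$ where at points $x=H(s)$ the equation is understood for each of the two one-sided second derivatives, the Neumann condition $w_s(s,s)=0$ for $s>0$ (with the one-sided derivative taken inside $\{x\le s\}$), and the transversality condition $$\lim_{T\uparrow\infty}e^{-rT}\,\mathsf E\bigl[w(X_T,S_T)\bigr]=0. \tag{TV}$$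 \textbf{Theorem.} \begin{enumerate} \item[(I)] $w$ is $C^1$ on $\{0<x\le s\}$, and its restriction to $\{0<x\le s,\ x\ne H(s)\}$ is $C^2$. \item[(II)] If $H_\infty\in\,]H_\infty^\circ,G_\infty]$, then $w(x,s)<0$ for some $0<x\le s$, and $w$ does not satisfy (VI). \item[(III)] If $H_\infty\in\,]0,H_\infty^\circ]$, then $w$ is strictly positive and satisfies (VI) and the Neumann condition. \item[(IV)] If $H_\infty\in\,]0,H_\infty^\circ[$, there is a constant $A_\infty>0$, depending only on $\mu,\sigma,r$ and $H_\infty$, such that, for every such filtered probability space and Brownian motion and every $0<x\le s$: (TV) fails, and for every sequence $(\tau_\ell)$ of bounded stopping times with $\tau_\ell\to\infty$ almost surely, $$\lim_{\ell\uparrow\infty}\mathsf E\bigl[e^{-r\tau_\ell}w(X_{\tau_\ell},S_{\tau_\ell})\bigr]\ \text{exists and is}\ \ge A_\infty x^n>0 .$$ \item[(V)] If $H_\infty=H_\infty^\circ$, then, for every such filtered probability space and Brownian motion and every $0<x\le s$: (TV) holds, and for every sequence $(\tau_\ell)$ of bounded stopping times with $\tau_\ell\to\infty$ almost surely, $\lim_{\ell\uparrow\infty}\mathsf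 E\bigl[e^{-r\tau_\ell}w(X_{\tau_\ell},S_{\tau_\ell})\bigr]=0$. \end{enumerate} In (IV) and (V) all the random variables whose expectations appear are integrable. -/

import Mathlib

open MeasureTheory ProbabilityTheory Filter Topology Set
open scoped NNReal ENNReal

universe u

namespace RunningMax

noncomputable section

/-! ### Problem data -/

/-- The smaller root `m` of `½ σ² k² + (μ - ½ σ²) k - r = 0`. -/
def rootM (μ σ r : ℝ) : ℝ :=
  -((μ - σ ^ 2 / 2) / σ ^ 2) - Real.sqrt (((μ - σ ^ 2 / 2) / σ ^ 2) ^ 2 + 2 * r / σ ^ 2)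

/-- The larger root `n` of `½ σ² k² + (μ - ½ σ²) k - r = 0`. -/
def rootN (μ σ r : ℝ) : ℝ :=
  -((μ - σ ^ 2 / 2) / σ ^ 2) + Real.sqrt (((μ - σ ^ 2 / 2) / σ ^ 2) ^ 2 + 2 * r / σ ^ 2)

/-- `F(s) = 1 - e^{-s}`. -/
def F (s : ℝ) : ℝ := 1 - Real.exp (-s)

/-- The reward function `R(x,s) = (x⁻¹ F(s) - 1)⁺`. -/
def reward (x s : ℝ) : ℝ := max (x⁻¹ * F s - 1) 0

/-- `G_∞ = (m+1)(n+1)/(mn)`. -/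
def GInf (μ σ r : ℝ) : ℝ :=
  (rootM μ σ r + 1) * (rootN μ σ r + 1) / (rootM μ σ r * rootN μ σ r)

/-- `G(s) = (m+1)(n+1)/(mn) · F(s)`. -/
def G (μ σ r s : ℝ) : ℝ := GInf μ σ r * F s

/-- `H_∞° = (m+1)/m`. -/
def HCrit (μ σ r : ℝ) : ℝ := (rootM μ σ r + 1) / rootM μ σ r

/-! ### The free-boundary function -/

/-- The right-hand side of the free-boundary ODE at `(s, h)`; here `F'(s) = e^{-s}`. -/
def odeRhs (μ σ r s h : ℝ) : ℝ :=
  Real.exp (-s) *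
      ((rootN μ σ r + 1) * (h / s) ^ (rootN μ σ r - rootM μ σ r) - (rootM μ σ r + 1)) * h /
    (-(rootM μ σ r * rootN μ σ r) * (G μ σ r s - h) *
      (1 - (h / s) ^ (rootN μ σ r - rootM μ σ r)))

/-- `H` solves the free-boundary ODE on `]0,∞[`, satisfies `0 < H < G` and `H' > 0` there,
vanishes at `0+` and tends to `Hinf` at infinity. -/
structure IsFreeBoundary (μ σ r Hinf : ℝ) (H : ℝ → ℝ) : Prop where
  ode : ∀ s, 0 < s → HasDerivAt H (odeRhs μ σ r s (H s)) s
  pos : ∀ s, 0 < s → 0 < H s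
  lt_G : ∀ s, 0 < s → H s < G μ σ r s
  deriv_pos : ∀ s, 0 < s → 0 < deriv H s
  tendsto_zero : Tendsto H (𝓝[>] 0) (𝓝 0)
  tendsto_top : Tendsto H atTop (𝓝 Hinf)

/-! ### The candidate function -/

/-- `A(s) = (m H(s) - (m+1) F(s)) / ((n-m) H(s)^{n+1})`. -/
def coefA (μ σ r : ℝ) (H : ℝ → ℝ) (s : ℝ) : ℝ :=
  (rootM μ σ r * H s - (rootM μ σ r + 1) * F s) /
    ((rootN μ σ r - rootM μ σ r) * H s ^ (rootN μ σ r + 1))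

/-- `B(s) = ((n+1) F(s) - n H(s)) / ((n-m) H(s)^{m+1})`. -/
def coefB (μ σ r : ℝ) (H : ℝ → ℝ) (s : ℝ) : ℝ :=
  ((rootN μ σ r + 1) * F s - rootN μ σ r * H s) /
    ((rootN μ σ r - rootM μ σ r) * H s ^ (rootM μ σ r + 1))

open Classical in
/-- The candidate `w(x,s)`; only its values for `0 < x ≤ s` matter. -/
def cand (μ σ r : ℝ) (H : ℝ → ℝ) (x s : ℝ) : ℝ :=
  if x ≤ H s then x⁻¹ * F s - 1
  else coefA μ σ r H s * x ^ rootN μ σ r + coefB μ σ r H s * x ^ rootM μ σ r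

/-- The state space `{(x,s) : 0 < x ≤ s}`. -/
def stateSpace : Set (ℝ × ℝ) := {p | 0 < p.1 ∧ p.1 ≤ p.2}

/-! ### The variational inequality and the Neumann condition -/

/-- The first partial derivative `w_x(x,s)`, taken inside the state space (so that it is the
left-hand derivative on the diagonal). -/
def wx (w : ℝ → ℝ → ℝ) (x s : ℝ) : ℝ := derivWithin (fun y => w y s) (Ioc 0 s) x

/-- The left-hand second derivative in `x`. -/
def wxxLeft (w : ℝ → ℝ → ℝ) (x s : ℝ) : ℝ := derivWithin (fun y => wx w y s) (Ioc 0 x) x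

/-- The right-hand second derivative in `x` (used only for `x < s`). -/
def wxxRight (w : ℝ → ℝ → ℝ) (x s : ℝ) : ℝ := derivWithin (fun y => wx w y s) (Ico x s) x

/-- `½ σ² x² c + μ x b - r a`, for `a = w`, `b = w_x`, `c = w_xx`. -/
def genOp (μ σ r x a b c : ℝ) : ℝ := σ ^ 2 * x ^ 2 * c / 2 + μ * x * b - r * a

/-- `w` satisfies `max {ℒ w, R - w} = 0` on `{0 < x ≤ s}`. At every point where `w_xx` exists
both one-sided second derivatives equal `w_xx` and this is the plain variational inequality; at
points where `w_xx` jumps the equation is required with each one-sided second derivative. -/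
def SolvesVI (μ σ r : ℝ) (w : ℝ → ℝ → ℝ) : Prop :=
  ∀ x s : ℝ, 0 < x → x ≤ s →
    DifferentiableWithinAt ℝ (fun y => w y s) (Ioc 0 s) x ∧
    DifferentiableWithinAt ℝ (fun y => wx w y s) (Ioc 0 x) x ∧
    max (genOp μ σ r x (w x s) (wx w x s) (wxxLeft w x s)) (reward x s - w x s) = 0 ∧
    (x < s →
      DifferentiableWithinAt ℝ (fun y => wx w y s) (Ico x s) x ∧
      max (genOp μ σ r x (w x s) (wx w x s) (wxxRight w x s)) (reward x s - w x s) = 0)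

/-- The Neumann condition `w_s(s,s) = 0` for `s > 0`, with the derivative in the second variable
taken inside the state space. -/
def SolvesNeumann (w : ℝ → ℝ → ℝ) : Prop :=
  ∀ s : ℝ, 0 < s → HasDerivWithinAt (fun u => w s u) 0 (Ici s) s

/-! ### The stochastic model -/

section Stochastic

variable {Ω : Type u} {mΩ : MeasurableSpace Ω}

/-- The filtered space satisfies the usual conditions and `W` is a standard one-dimensional
Brownian motion relative to the filtration. -/
structure IsBrownianSetup (P : Measure Ω) (ℱ : Filtration ℝ≥0 mΩ) (W : ℝ≥0 → Ω → ℝ) : Prop where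
  null_mem : ∀ N : Set Ω, P N = 0 → MeasurableSet[ℱ 0] N
  rightCont : ℱ.IsRightContinuous
  brownian : IsBrownianReal W P
  adapted : ∀ t, Measurable[ℱ t] (W t)
  indep : ∀ t₁ t₂ : ℝ≥0, t₁ ≤ t₂ →
    Indep (MeasurableSpace.comap (fun ω => W t₂ ω - W t₁ ω) inferInstance) (ℱ t₁) P

/-- The geometric Brownian motion `X_t = x exp((μ - ½ σ²) t + σ W_t)` started at `x`, which is the
solution to `dX = μ X dt + σ X dW`. -/
def gbm (μ σ : ℝ) (W : ℝ≥0 → Ω → ℝ) (x : ℝ) (t : ℝ≥0) (ω : Ω) : ℝ :=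
  x * Real.exp ((μ - σ ^ 2 / 2) * t + σ * W t ω)

/-- The running maximum `S_t = max {s, max_{0 ≤ u ≤ t} X_u}`. -/
def runMax (μ σ : ℝ) (W : ℝ≥0 → Ω → ℝ) (x s : ℝ) (t : ℝ≥0) (ω : Ω) : ℝ :=
  max s (sSup ((fun v : ℝ≥0 => gbm μ σ W x v ω) '' Icc 0 t))

/-- The random variable `e^{-rτ} w(X_τ, S_τ)` for the process started at `(x,s)`. -/
def discounted (μ σ r : ℝ) (w : ℝ → ℝ → ℝ) (W : ℝ≥0 → Ω → ℝ) (x s : ℝ) (τ : Ω → ℝ≥0)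
    (ω : Ω) : ℝ :=
  Real.exp (-r * (τ ω : ℝ)) * w (gbm μ σ W x (τ ω) ω) (runMax μ σ W x s (τ ω) ω)

/-- The transversality condition `lim_{T → ∞} e^{-rT} E[w(X_T, S_T)] = 0`, started at `(x,s)`. -/
def Transversality (μ σ r : ℝ) (w : ℝ → ℝ → ℝ) (P : Measure Ω) (W : ℝ≥0 → Ω → ℝ)
    (x s : ℝ) : Prop :=
  Tendsto (fun T : ℝ≥0 => Real.exp (-r * (T : ℝ)) *
    ∫ ω, w (gbm μ σ W x T ω) (runMax μ σ W x s T ω) ∂P) atTop (𝓝 0)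

/-- `(τ_ℓ)` is a sequence of bounded stopping times tending to infinity almost surely. -/
structure IsBoundedStoppingSeq (P : Measure Ω) (ℱ : Filtration ℝ≥0 mΩ)
    (τ : ℕ → Ω → ℝ≥0) : Prop where
  stopping : ∀ l, IsStoppingTime ℱ (fun ω => (τ l ω : WithTop ℝ≥0))
  bounded : ∀ l, ∃ C : ℝ≥0, ∀ ω, τ l ω ≤ C
  tendsto_top : ∀ᵐ ω ∂P, Tendsto (fun l => τ l ω) atTop atTop

end Stochastic

end

end RunningMax

open RunningMax

/-!
Write `ρ = (H/s)^(n-m) ∈ ]0,1[`. The free-boundary equation is equivalent to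
`A' = -F' H^{-n-1} ρ/(1-ρ)` and `B' = F' H^{-m-1}/(1-ρ)` (`hasDerivAt_coefA`, `hasDerivAt_coefB`).
These two derivatives cancel in `A' s^n + B' s^m`, which is the Neumann condition, and `A` is
strictly decreasing, with limit
`A_∞ = (m H_∞ - (m+1)) / ((n-m) H_∞^{n+1})` at infinity (`limA`). The sign of `A_∞` is that of
`H_∞° - H_∞`, and this separates the cases.

*Regularity.* The right-hand side of the equation is smooth along its solution, so `H` is `C²`. The
two expressions for `w` and their differentials agree on `x = H(s)`, hence they glue to a `C¹`
function (`contDiffOn_one_ite`).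

*Variational inequality.* If `A_∞ < 0`, then `w(s,s) = A s^n + B s^m → -∞`, whereas a solution
dominates the nonnegative payoff. If `A_∞ ≥ 0`, then `A > 0` and `B > 0`; the function `x w + x` is
a positive combination of `x^{n+1}`, `x^{m+1}` and `x`, so it is convex, and it is tangent to the
constant `F` at `x = H`, which gives `w ≥ R` (`lower_le_upper`). Below the boundary
`ℒ w = ((σ² - μ - r) F + r x)/x`, which is nonpositive because `H < G`.

*Transversality.* No stochastic calculus is needed. For `s ≥ s₀` and every `ε > 0`,
`A_∞ x^n - C x⁻¹ ≤ w(x,s) ≤ (A_∞ + ε) x^n + C_ε x⁻¹` (`le_cand`, `exists_cand_le`). The process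
`e^{-rt} X_t^n` is an exponential martingale, and `e^{-rt} X_t⁻¹` is an exponential martingale times
`e^{-δt}` with `δ = r + μ - σ² > 0`. By optional sampling the former has expectation `x^n` at every
bounded stopping time, and the expectation of the latter tends to zero along `τ_ℓ`
(`optionalSampling`, `tendsto_discounted_expMart`). So `E[e^{-rτ_ℓ} w] → A_∞ x^n`
(`tendsto_integral_discounted`), which is positive if `H_∞ < H_∞°` and zero if `H_∞ = H_∞°`.
-/

namespace RunningMax

noncomputable section

/-! ### Optional sampling in continuous time -/

section OptionalSampling

variable {Ω : Type*} {mΩ : MeasurableSpace Ω} {P : Measure Ω} {ℱ : Filtration ℝ≥0 mΩ}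

/-- The smallest multiple of `1 / (k + 1)` strictly greater than `t`. -/
def discretize (k : ℕ) (t : ℝ≥0) : ℝ≥0 := (⌊((k : ℝ≥0) + 1) * t⌋₊ + 1) / ((k : ℝ≥0) + 1)

lemma le_discretize (k : ℕ) (t : ℝ≥0) : t ≤ discretize k t := by
  rw [discretize, le_div_iff₀ (by positivity), mul_comm]
  exact (Nat.lt_floor_add_one _).le

lemma discretize_le (k : ℕ) (t : ℝ≥0) : discretize k t ≤ t + 1 / ((k : ℝ≥0) + 1) := by
  rw [discretize, add_div]
  gcongr
  rw [div_le_iff₀ (by positivity), mul_comm t]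
  exact Nat.floor_le zero_le

lemma tendsto_discretize (t : ℝ≥0) : Tendsto (fun k => discretize k t) atTop (𝓝 t) := by
  refine tendsto_of_tendsto_of_tendsto_of_le_of_le tendsto_const_nhds ?_
    (fun k => le_discretize k t) (fun k => discretize_le k t)
  simpa using (tendsto_const_nhds (x := t)).add (tendsto_one_div_add_atTop_nhds_zero_nat (𝕜 := ℝ≥0))

lemma isStoppingTime_discretize {τ : Ω → ℝ≥0}
    (hτ : IsStoppingTime ℱ (fun ω => (τ ω : WithTop ℝ≥0))) (k : ℕ) :
    IsStoppingTime ℱ (fun ω => (discretize k (τ ω) : WithTop ℝ≥0)) := by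
  intro i
  set j : ℝ≥0 := (⌊((k : ℝ≥0) + 1) * i⌋₊ : ℝ≥0) / ((k : ℝ≥0) + 1) with hj
  have hji : j ≤ i := by
    rw [hj, div_le_iff₀ (by positivity), mul_comm i]
    exact Nat.floor_le zero_le
  have key : {ω | ((discretize k (τ ω) : ℝ≥0) : WithTop ℝ≥0) ≤ i}
      = {ω | ((τ ω : ℝ≥0) : WithTop ℝ≥0) < j} := by
    ext ω
    simp only [Set.mem_ofPred_eq, WithTop.coe_le_coe, WithTop.coe_lt_coe]
    rw [discretize, div_le_iff₀ (by positivity), hj, lt_div_iff₀ (by positivity),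
      mul_comm i, mul_comm (τ ω)]
    rw [← Nat.floor_lt zero_le, ← Nat.add_one_le_iff, Nat.le_floor_iff zero_le]
    push_cast
    rfl
  rw [key]
  exact ℱ.mono hji _ (hτ.measurableSet_lt j)

/-- Optional sampling for a martingale with almost surely continuous paths and a bounded stopping
time. The values at the discretised stopping times are conditional expectations of a single
random variable, hence uniformly integrable. -/
theorem optionalSampling [IsProbabilityMeasure P] {f : ℝ≥0 → Ω → ℝ} (hf : Martingale f ℱ P)
    (hc : ∀ᵐ ω ∂P, Continuous fun t => f t ω) {τ : Ω → ℝ≥0}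
    (hτ : IsStoppingTime ℱ (fun ω => (τ ω : WithTop ℝ≥0))) {C : ℝ≥0} (hC : ∀ ω, τ ω ≤ C) :
    Integrable (fun ω => f (τ ω) ω) P ∧ ∫ ω, f (τ ω) ω ∂P = ∫ ω, f 0 ω ∂P := by
  have hτk := isStoppingTime_discretize hτ
  have hle : ∀ k ω, ((discretize k (τ ω) : ℝ≥0) : WithTop ℝ≥0) ≤ ((C + 1 : ℝ≥0) : WithTop ℝ≥0) := by
    intro k ω
    rw [WithTop.coe_le_coe]
    refine (discretize_le k _).trans (add_le_add (hC ω) ?_)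
    rw [div_le_one (by positivity)]
    simp
  have hcount : ∀ k, (Set.range fun ω => ((discretize k (τ ω) : ℝ≥0) : WithTop ℝ≥0)).Countable := by
    intro k
    refine (Set.countable_range (fun i : ℕ =>
      ((((i : ℝ≥0) + 1) / ((k : ℝ≥0) + 1) : ℝ≥0) : WithTop ℝ≥0))).mono ?_
    rintro _ ⟨ω, rfl⟩
    exact ⟨⌊((k : ℝ≥0) + 1) * τ ω⌋₊, rfl⟩
  have hae : ∀ k, (fun ω => f (discretize k (τ ω)) ω)
      =ᵐ[P] P[f (C + 1) | (hτk k).measurableSpace] := fun k =>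
    hf.stoppedValue_ae_eq_condExp_of_le_const_of_countable_range (hτk k) (hle k) (hcount k)
  have hui : UniformIntegrable (fun k ω => f (discretize k (τ ω)) ω) 1 P :=
    ((hf.integrable (C + 1)).uniformIntegrable_condExp
      (fun k => (hτk k).measurableSpace_le)).ae_eq (fun k => (hae k).symm)
  have hlim : ∀ᵐ ω ∂P, Tendsto (fun k => f (discretize k (τ ω)) ω) atTop (𝓝 (f (τ ω) ω)) := by
    filter_upwards [hc] with ω hω
    exact (hω.tendsto (τ ω)).comp (tendsto_discretize (τ ω))
  have hint : Integrable (fun ω => f (τ ω) ω) P := hui.integrable_of_ae_tendsto hlim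
  refine ⟨hint, ?_⟩
  have hL1 := tendsto_Lp_finite_of_tendsto_ae le_rfl ENNReal.one_ne_top (fun k => hui.1 k)
    (memLp_one_iff_integrable.2 hint) hui.2.1 hlim
  have hI := tendsto_integral_of_L1' (μ := P) _ hint.1
    (Eventually.of_forall fun k => memLp_one_iff_integrable.1 (hui.memLp k)) hL1
  refine tendsto_nhds_unique hI ?_
  have : ∀ k, ∫ ω, f (discretize k (τ ω)) ω ∂P = ∫ ω, f 0 ω ∂P := by
    intro k
    rw [integral_congr_ae (hae k), integral_condExp]
    have h1 := integral_congr_ae (hf.condExp_ae_eq (zero_le : (0 : ℝ≥0) ≤ C + 1))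
    rw [integral_condExp] at h1
    exact h1
  simp only [this]
  exact tendsto_const_nhds

end OptionalSampling

/-! ### Exponential martingales -/

section ExpMartingale

variable {Ω : Type u} {mΩ : MeasurableSpace Ω} {P : Measure Ω} {ℱ : Filtration ℝ≥0 mΩ}
  {W : ℝ≥0 → Ω → ℝ}

/-- The exponential martingale `exp (a W_t - a² t / 2)`. -/
def expMart (a : ℝ) (W : ℝ≥0 → Ω → ℝ) (t : ℝ≥0) (ω : Ω) : ℝ :=
  Real.exp (a * W t ω - a ^ 2 * t / 2)

lemma expMart_pos (a : ℝ) (W : ℝ≥0 → Ω → ℝ) (t : ℝ≥0) (ω : Ω) : 0 < expMart a W t ω :=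
  Real.exp_pos _

lemma integrable_exp_of_hasLaw {Y : Ω → ℝ} {v : ℝ≥0} (hY : HasLaw Y (gaussianReal 0 v) P)
    (a : ℝ) : Integrable (fun ω => Real.exp (a * Y ω)) P := by
  have h := integrable_exp_mul_gaussianReal (μ := 0) (v := v) a
  rw [← hY.map_eq] at h
  exact h.comp_aemeasurable hY.aemeasurable

lemma integral_exp_of_hasLaw {Y : Ω → ℝ} {v : ℝ≥0} (hY : HasLaw Y (gaussianReal 0 v) P)
    (a : ℝ) : ∫ ω, Real.exp (a * Y ω) ∂P = Real.exp (v * a ^ 2 / 2) := by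
  have h := mgf_gaussianReal hY.map_eq a
  rw [mgf] at h
  simpa using h

variable [IsProbabilityMeasure P]

lemma martingale_expMart (hW : IsBrownianSetup P ℱ W) (a : ℝ) : Martingale (expMart a W) ℱ P := by
  have hint : ∀ t, Integrable (expMart a W t) P := by
    intro t
    have h := (integrable_exp_of_hasLaw (hW.brownian.hasLaw_eval t) a).mul_const
      (Real.exp (-(a ^ 2 * t / 2)))
    refine h.congr (Eventually.of_forall fun ω => ?_)
    simp only [expMart]
    rw [← Real.exp_add]; ring_nf
  have hadapted : ∀ t, StronglyMeasurable[ℱ t] (expMart a W t) := by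
    intro t
    have := hW.adapted t
    refine Measurable.stronglyMeasurable ?_
    exact Real.measurable_exp.comp ((this.const_mul a).sub_const _)
  refine ⟨hadapted, fun s t hst => ?_⟩
  let D : Ω → ℝ := fun ω => W t ω - W s ω
  have hD : HasLaw D (gaussianReal 0 (t - s)) P := by
    have h := hW.brownian.hasLaw_sub t s
    have e : nndist t.1 s.1 = t - s := by
      rw [← NNReal.coe_inj, coe_nndist, Real.dist_eq, NNReal.coe_sub hst]
      exact abs_of_nonneg (sub_nonneg.2 hst)
    rwa [e] at h
  have hDle : MeasurableSpace.comap D inferInstance ≤ mΩ := by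
    have h1 : Measurable D :=
      ((hW.adapted t).mono (ℱ.le t) le_rfl).sub ((hW.adapted s).mono (ℱ.le s) le_rfl)
    exact h1.comap_le
  let g : Ω → ℝ := fun ω => Real.exp (a * D ω)
  have hgm : StronglyMeasurable[MeasurableSpace.comap D inferInstance] g := by
    refine Measurable.stronglyMeasurable ?_
    exact Real.measurable_exp.comp ((comap_measurable D).const_mul a)
  have hg : P[g | ℱ s] =ᵐ[P] fun _ => Real.exp (((t : ℝ) - s) * a ^ 2 / 2) := by
    have h := condExp_indep_eq hDle (ℱ.le s) hgm (hW.indep s t hst)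
    rw [integral_exp_of_hasLaw hD a, NNReal.coe_sub hst] at h
    exact h
  let c : Ω → ℝ := fun ω => expMart a W s ω * Real.exp (-(((t : ℝ) - s) * a ^ 2 / 2))
  have hcm : StronglyMeasurable[ℱ s] c := (hadapted s).mul_const _
  have hdec : expMart a W t = c * g := by
    ext ω
    simp only [expMart, c, g, D, Pi.mul_apply]
    rw [← Real.exp_add, ← Real.exp_add]
    congr 1; ring
  have hgi : Integrable g P := integrable_exp_of_hasLaw hD a
  have hpull := condExp_mul_of_stronglyMeasurable_left (μ := P) hcm (hdec ▸ hint t) hgi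
  rw [hdec]
  refine hpull.trans ?_
  filter_upwards [hg] with ω hω
  simp only [Pi.mul_apply, hω, c]
  rw [mul_assoc, ← Real.exp_add]
  simp

omit [IsProbabilityMeasure P] in
lemma continuous_expMart (hW : IsBrownianSetup P ℱ W) (a : ℝ) :
    ∀ᵐ ω ∂P, Continuous fun t => expMart a W t ω := by
  filter_upwards [hW.brownian.cont] with ω hω
  unfold expMart
  fun_prop

lemma integral_expMart_zero (hW : IsBrownianSetup P ℱ W) (a : ℝ) :
    ∫ ω, expMart a W 0 ω ∂P = 1 := by
  have h : expMart a W 0 =ᵐ[P] fun _ => (1 : ℝ) := by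
    filter_upwards [hW.brownian.eval_zero_ae_eq_zero] with ω hω
    simp [expMart, hω]
  rw [integral_congr_ae h]; simp

/-- Exponential martingales have expectation one at bounded stopping times. -/
lemma integrable_expMart_stopped (hW : IsBrownianSetup P ℱ W) (a : ℝ) {τ : Ω → ℝ≥0}
    (hτ : IsStoppingTime ℱ (fun ω => (τ ω : WithTop ℝ≥0))) {C : ℝ≥0} (hC : ∀ ω, τ ω ≤ C) :
    Integrable (fun ω => expMart a W (τ ω) ω) P ∧ ∫ ω, expMart a W (τ ω) ω ∂P = 1 := by
  have h := optionalSampling (martingale_expMart hW a) (continuous_expMart hW a) hτ hC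
  rwa [integral_expMart_zero hW a] at h

lemma measurable_of_isStoppingTime {τ : Ω → ℝ≥0}
    (hτ : IsStoppingTime ℱ (fun ω => (τ ω : WithTop ℝ≥0))) : Measurable τ := by
  refine measurable_of_Iic fun t => ?_
  have h := ℱ.le t _ (hτ t)
  have e : τ ⁻¹' Iic t = {ω | (τ ω : WithTop ℝ≥0) ≤ t} := by
    ext ω
    exact (WithTop.coe_le_coe (a := t) (b := τ ω)).symm
  rwa [e]

/-- The part of the expectation carried by `{τ ≤ T}` is controlled by `P (τ ≤ T)`: the martingale
stopped at `τ ∧ T` is bounded in `L²`. -/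
lemma discounted_expMart_le (hW : IsBrownianSetup P ℱ W) (a : ℝ) {δ : ℝ} (hδ : 0 < δ)
    {τ : Ω → ℝ≥0} (hτ : IsStoppingTime ℱ (fun ω => (τ ω : WithTop ℝ≥0))) {C : ℝ≥0}
    (hC : ∀ ω, τ ω ≤ C) (T : ℝ≥0) {ε : ℝ} (hε : 0 < ε) :
    Integrable (fun ω => Real.exp (-δ * τ ω) * expMart a W (τ ω) ω) P ∧
    ∫ ω, Real.exp (-δ * τ ω) * expMart a W (τ ω) ω ∂P ≤
      Real.exp (-δ * T) + ε * Real.exp (a ^ 2 * T) + P.real {ω | τ ω ≤ T} / (4 * ε) := by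
  have hτm := measurable_of_isStoppingTime hτ
  obtain ⟨hi, h1⟩ := integrable_expMart_stopped hW a hτ hC
  have hmin : IsStoppingTime ℱ (fun ω => ((min (τ ω) T : ℝ≥0) : WithTop ℝ≥0)) := by
    have := hτ.min_const T
    simpa using this
  obtain ⟨hi2, h2⟩ := integrable_expMart_stopped hW (2 * a) hmin (C := T) (fun ω => min_le_right _ _)
  have hset : MeasurableSet {ω | τ ω ≤ T} := hτm measurableSet_Iic
  have hind : Integrable ({ω | τ ω ≤ T}.indicator fun _ => (1 : ℝ)) P :=
    (integrable_const 1).indicator hset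
  have hint : Integrable (fun ω => Real.exp (-δ * τ ω) * expMart a W (τ ω) ω) P := by
    refine hi.bdd_mul (c := 1) (by fun_prop) (Eventually.of_forall fun ω => ?_)
    rw [Real.norm_eq_abs, abs_of_pos (Real.exp_pos _), Real.exp_le_one_iff]
    have : (0 : ℝ) ≤ τ ω := (τ ω).2
    nlinarith
  refine ⟨hint, ?_⟩
  have hpt : ∀ ω, Real.exp (-δ * τ ω) * expMart a W (τ ω) ω ≤
      Real.exp (-δ * T) * expMart a W (τ ω) ω
        + ε * Real.exp (a ^ 2 * T) * expMart (2 * a) W (min (τ ω) T) ω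
        + ({ω | τ ω ≤ T}.indicator (fun _ => (1 : ℝ)) ω) / (4 * ε) := by
    intro ω
    have hp := expMart_pos a W (τ ω) ω
    have hp2 := expMart_pos (2 * a) W (min (τ ω) T) ω
    by_cases h : τ ω ≤ T
    · have hind1 : ({ω | τ ω ≤ T}.indicator (fun _ => (1 : ℝ)) ω) = 1 :=
        Set.indicator_of_mem (s := {ω | τ ω ≤ T}) h _
      rw [hind1, min_eq_left h]
      set y := expMart a W (τ ω) ω
      have hsq : y ^ 2 ≤ Real.exp (a ^ 2 * T) * expMart (2 * a) W (τ ω) ω := by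
        simp only [y, expMart]
        rw [← Real.exp_nat_mul, ← Real.exp_add]
        refine Real.exp_le_exp.2 ?_
        have hh : (τ ω : ℝ) ≤ T := h
        have := mul_le_mul_of_nonneg_left hh (sq_nonneg a)
        push_cast
        linarith
      have e1 : Real.exp (-δ * τ ω) ≤ 1 := by
        rw [Real.exp_le_one_iff]
        have : (0 : ℝ) ≤ τ ω := (τ ω).2
        nlinarith
      have e2 : y ≤ ε * y ^ 2 + 1 / (4 * ε) := by
        have : 0 ≤ (2 * ε * y - 1) ^ 2 / (4 * ε) := by positivity
        have e : (2 * ε * y - 1) ^ 2 / (4 * ε) = ε * y ^ 2 + 1 / (4 * ε) - y := by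
          field_simp; ring
        linarith
      have e3 : Real.exp (-δ * τ ω) * y ≤ y := by nlinarith
      have e4 : 0 ≤ Real.exp (-δ * T) * y := by positivity
      have e5 := mul_le_mul_of_nonneg_left hsq hε.le
      linarith
    · have hind0 : 0 ≤ ({ω | τ ω ≤ T}.indicator (fun _ => (1 : ℝ)) ω) / (4 * ε) := by
        refine div_nonneg (Set.indicator_nonneg (fun _ _ => zero_le_one) _) (by positivity)
      have hh : (T : ℝ) ≤ τ ω := (not_le.1 h).le
      have e1 : Real.exp (-δ * τ ω) ≤ Real.exp (-δ * T) := by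
        refine Real.exp_le_exp.2 ?_
        nlinarith
      have e2 := mul_le_mul_of_nonneg_right e1 hp.le
      have e3 : 0 ≤ ε * Real.exp (a ^ 2 * T) * expMart (2 * a) W (min (τ ω) T) ω := by positivity
      linarith
  have hI1 := hi.const_mul (Real.exp (-δ * T))
  have hI2 := hi2.const_mul (ε * Real.exp (a ^ 2 * T))
  have hI3 := hind.div_const (4 * ε)
  have h := integral_mono hint ((hI1.add hI2).add hI3) hpt
  refine h.trans (le_of_eq ?_)
  rw [integral_add' (hI1.add hI2) hI3, integral_add' hI1 hI2, integral_const_mul, integral_const_mul, h1, h2,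
    integral_div, integral_indicator_const _ hset]
  simp

/-- Read as the expectation of `e^{-δτ_ℓ}` under the measure with density process `expMart`, this
would be dominated convergence, except that this measure may be singular to `P`, so that `τ_ℓ` need
not tend to infinity almost surely under it. Convergence in probability survives, and
`discounted_expMart_le` expresses this without a change of measure. -/
lemma tendsto_discounted_expMart (hW : IsBrownianSetup P ℱ W) (a : ℝ) {δ : ℝ} (hδ : 0 < δ)
    {τ : ℕ → Ω → ℝ≥0} (hτ : IsBoundedStoppingSeq P ℱ τ) :
    Tendsto (fun l => ∫ ω, Real.exp (-δ * τ l ω) * expMart a W (τ l ω) ω ∂P) atTop (𝓝 0) := by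
  have hprob : ∀ T : ℝ≥0, Tendsto (fun l => P.real {ω | τ l ω ≤ T}) atTop (𝓝 0) := by
    intro T
    have hm : ∀ l, MeasurableSet {ω | τ l ω ≤ T} := fun l =>
      measurable_of_isStoppingTime (hτ.stopping l) measurableSet_Iic
    have h := tendsto_integral_of_dominated_convergence (μ := P) (fun _ => (1 : ℝ))
      (F := fun l => {ω | τ l ω ≤ T}.indicator fun _ => (1 : ℝ)) (f := fun _ => 0)
      (fun l => (measurable_const.indicator (hm l)).aestronglyMeasurable) (integrable_const 1)
      (fun l => Eventually.of_forall fun ω => by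
        rw [Set.indicator_apply]; split_ifs <;> simp) (by
        filter_upwards [hτ.tendsto_top] with ω hω
        refine tendsto_const_nhds.congr' ?_
        filter_upwards [hω.eventually_gt_atTop T] with l hl
        exact (Set.indicator_of_notMem (s := {ω | τ l ω ≤ T}) (not_le.2 hl) _).symm)
    simp only [integral_zero] at h
    refine h.congr fun l => ?_
    rw [integral_indicator_const _ (hm l)]; simp
  rw [Metric.tendsto_atTop]
  intro η hη
  obtain ⟨T, hT⟩ : ∃ T : ℝ≥0, Real.exp (-δ * T) < η / 3 := by
    have h : Tendsto (fun T : ℝ≥0 => Real.exp (-δ * T)) atTop (𝓝 0) := by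
      refine Real.tendsto_exp_atBot.comp ?_
      exact (NNReal.tendsto_coe_atTop.2 tendsto_id).const_mul_atTop_of_neg (by linarith)
    exact (h.eventually_lt_const (by positivity)).exists
  set ε := η / (3 * Real.exp (a ^ 2 * T)) with hεdef
  have hε : 0 < ε := by positivity
  have hε2 : ε * Real.exp (a ^ 2 * T) = η / 3 := by rw [hεdef]; field_simp
  obtain ⟨N, hN⟩ := (((hprob T).div_const (4 * ε)).eventually_lt_const
    (show 0 / (4 * ε) < η / 3 by rw [zero_div]; positivity)).exists_forall_of_atTop
  refine ⟨N, fun l hl => ?_⟩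
  obtain ⟨C, hC⟩ := hτ.bounded l
  have h1 := (discounted_expMart_le hW a hδ (hτ.stopping l) hC T hε).2
  have h2 := hN l hl
  have h0 : 0 ≤ ∫ ω, Real.exp (-δ * τ l ω) * expMart a W (τ l ω) ω ∂P :=
    integral_nonneg fun ω => mul_nonneg (Real.exp_pos _).le (expMart_pos _ _ _ _).le
  rw [Real.dist_eq, sub_zero, abs_of_nonneg h0]
  linarith

end ExpMartingale

/-! ### The process and its running maximum at a random time -/

section Paths

variable {Ω : Type u} {mΩ : MeasurableSpace Ω} {P : Measure Ω} {ℱ : Filtration ℝ≥0 mΩ}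
  {W : ℝ≥0 → Ω → ℝ}

lemma gbm_pos {μ σ x : ℝ} (hx : 0 < x) (W : ℝ≥0 → Ω → ℝ) (t : ℝ≥0) (ω : Ω) :
    0 < gbm μ σ W x t ω := mul_pos hx (Real.exp_pos _)

lemma le_runMax (μ σ x s : ℝ) (W : ℝ≥0 → Ω → ℝ) (t : ℝ≥0) (ω : Ω) :
    s ≤ runMax μ σ W x s t ω := le_max_left _ _

lemma continuous_gbm {μ σ x : ℝ} {ω : Ω} (h : Continuous fun t => W t ω) :
    Continuous fun t => gbm μ σ W x t ω := by
  unfold gbm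
  fun_prop

lemma gbm_le_runMax {μ σ x s : ℝ} {ω : Ω} (h : Continuous fun t => W t ω) (t : ℝ≥0) :
    gbm μ σ W x t ω ≤ runMax μ σ W x s t ω := by
  refine le_trans ?_ (le_max_right _ _)
  refine le_csSup ?_ ⟨t, ⟨zero_le, le_rfl⟩, rfl⟩
  exact (isCompact_Icc.image (continuous_gbm h)).bddAbove

lemma sSup_image_eq_of_subset_closure {f : ℝ≥0 → ℝ} (hf : Continuous f) {D K : Set ℝ≥0}
    (hDK : D ⊆ K) (hKD : K ⊆ closure D) (hne : K.Nonempty) (hK : IsCompact K) :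
    sSup (f '' K) = sSup (f '' D) := by
  have hbK : BddAbove (f '' K) := (hK.image hf).bddAbove
  have hbD : BddAbove (f '' D) := hbK.mono (image_mono hDK)
  have hDne : D.Nonempty := closure_nonempty_iff.1 (hne.mono hKD)
  refine le_antisymm (csSup_le (hne.image f) ?_) (csSup_le_csSup hbK (hDne.image f) (image_mono hDK))
  rintro _ ⟨k, hk, rfl⟩
  have h1 : f k ∈ closure (f '' D) := image_closure_subset_closure_image hf ⟨k, hKD hk, rfl⟩
  exact closure_minimal (fun y hy => le_csSup hbD hy) isClosed_Iic h1

/-- At a random time `τ`, the position and the running maximum agree almost surely with a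
measurable random vector. The supremum over `[0, τ]` is rewritten as the supremum of
`u ↦ X (u τ)` over a countable dense subset of `[0, 1]`. -/
lemma aemeasurable_gbm_runMax (hW : IsBrownianSetup P ℱ W) (μ σ x s : ℝ) {τ : Ω → ℝ≥0}
    (hτ : Measurable τ) :
    AEMeasurable (fun ω => (gbm μ σ W x (τ ω) ω, runMax μ σ W x s (τ ω) ω)) P := by
  set N : Set Ω := toMeasurable P {ω | ¬ Continuous fun t => W t ω} with hN
  have hN0 : P N = 0 := by
    rw [hN, measure_toMeasurable]
    exact ae_iff.1 hW.brownian.cont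
  let V : ℝ≥0 → Ω → ℝ := fun t => Nᶜ.indicator (W t)
  have hVm : ∀ t, Measurable (V t) := fun t =>
    ((hW.adapted t).mono (ℱ.le t) le_rfl).indicator (measurableSet_toMeasurable _ _).compl
  have hVW : ∀ ω, ω ∉ N → ∀ t, V t ω = W t ω := fun ω hω t =>
    Set.indicator_of_mem (s := Nᶜ) hω _
  have hVc : ∀ ω, Continuous fun t => V t ω := by
    intro ω
    by_cases hω : ω ∈ N
    · have : (fun t => V t ω) = fun _ => 0 := by
        ext t
        exact Set.indicator_of_notMem (s := Nᶜ) (fun h => h hω) _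
      rw [this]; exact continuous_const
    · have : (fun t => V t ω) = fun t => W t ω := funext fun t => hVW ω hω t
      rw [this]
      by_contra h
      exact hω (subset_toMeasurable P _ h)
  have hjoint : Measurable (Function.uncurry fun t ω => gbm μ σ V x t ω) := by
    refine measurable_uncurry_of_continuous_of_measurable (fun ω => continuous_gbm (hVc ω)) ?_
    intro t
    unfold gbm
    have := hVm t
    fun_prop
  obtain ⟨D, hD, hDc, hDd⟩ :=
    (TopologicalSpace.IsSeparable.of_separableSpace (Icc (0 : ℝ≥0) 1)).exists_countable_dense_subset
  have hX : ∀ u : ℝ≥0, Measurable fun ω => gbm μ σ V x (u * τ ω) ω := fun u =>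
    hjoint.comp ((hτ.const_mul u).prodMk measurable_id)
  have hS : Measurable fun ω => max s (sSup ((fun u : ℝ≥0 => gbm μ σ V x (u * τ ω) ω) '' D)) :=
    measurable_const.max (Measurable.sSup hDc fun u _ => hX u)
  refine ⟨_, (by simpa using hX 1 : Measurable fun ω => gbm μ σ V x (τ ω) ω).prodMk hS, ?_⟩
  have hae : ∀ᵐ ω ∂P, ω ∉ N := measure_eq_zero_iff_ae_notMem.1 hN0
  filter_upwards [hae] with ω hω
  have hg : ∀ t, gbm μ σ V x t ω = gbm μ σ W x t ω := fun t => by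
    simp only [gbm, hVW ω hω]
  refine Prod.ext (hg _).symm ?_
  simp only [runMax]
  congr 1
  have hc : Continuous fun u : ℝ≥0 => gbm μ σ V x (u * τ ω) ω :=
    (continuous_gbm (hVc ω)).comp (continuous_mul_const _)
  rw [← sSup_image_eq_of_subset_closure hc hD hDd ⟨0, by simp⟩ isCompact_Icc]
  have himg : Icc 0 (τ ω) = (fun u => u * τ ω) '' Icc (0 : ℝ≥0) 1 := by
    ext v
    constructor
    · intro hv
      rcases eq_or_ne (τ ω) 0 with h0 | h0
      · refine ⟨0, by simp, ?_⟩
        have := hv.2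
        rw [h0] at this ⊢
        simpa using this.antisymm zero_le |>.symm
      · refine ⟨v / τ ω, ⟨zero_le, div_le_one_of_le₀ hv.2 zero_le⟩, ?_⟩
        exact div_mul_cancel₀ v h0
    · rintro ⟨u, hu, rfl⟩
      exact ⟨zero_le, mul_le_of_le_one_left zero_le hu.2⟩
  rw [himg, image_image]
  simp only [hg]

lemma aestronglyMeasurable_discounted (hW : IsBrownianSetup P ℱ W) (μ σ r : ℝ) {x s : ℝ}
    (hx : 0 < x) {τ : Ω → ℝ≥0} (hτ : Measurable τ)
    {w : ℝ → ℝ → ℝ} (hw : ContinuousOn (Function.uncurry w) stateSpace) :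
    AEStronglyMeasurable (discounted μ σ r w W x s τ) P := by
  have hms : MeasurableSet stateSpace :=
    (measurableSet_lt measurable_const measurable_fst).inter
      (measurableSet_le measurable_fst measurable_snd)
  classical
  have hwm : Measurable (stateSpace.piecewise (Function.uncurry w) fun _ => 0) :=
    hw.measurable_piecewise continuousOn_const hms
  have h1 := hwm.comp_aemeasurable (aemeasurable_gbm_runMax hW μ σ x s hτ)
  have h2 : Measurable fun ω => Real.exp (-r * (τ ω : ℝ)) := by fun_prop
  have h3 := (h2.aemeasurable (μ := P)).mul h1
  refine (h3.congr ?_).aestronglyMeasurable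
  filter_upwards [hW.brownian.cont] with ω hω
  have hmem : (gbm μ σ W x (τ ω) ω, runMax μ σ W x s (τ ω) ω) ∈ stateSpace :=
    ⟨gbm_pos hx W _ _, gbm_le_runMax hω _⟩
  simp only [Pi.mul_apply, Function.comp_apply, Set.piecewise_eq_of_mem _ _ _ hmem, discounted,
    Function.uncurry]

end Paths

/-! ### Discounted expectations along bounded stopping times -/

section Limits

variable {Ω : Type u} {mΩ : MeasurableSpace Ω} {P : Measure Ω} {ℱ : Filtration ℝ≥0 mΩ}
  {W : ℝ≥0 → Ω → ℝ}

lemma discounted_gbm_rpow {μ σ r x : ℝ} (hx : 0 < x) (k : ℝ) (W : ℝ≥0 → Ω → ℝ)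
    (t : ℝ≥0) (ω : Ω) :
    Real.exp (-r * t) * gbm μ σ W x t ω ^ k = x ^ k *
      (Real.exp (-(r - (σ ^ 2 * k ^ 2 / 2 + (μ - σ ^ 2 / 2) * k)) * t) *
        expMart (k * σ) W t ω) := by
  rw [gbm, Real.mul_rpow hx.le (Real.exp_pos _).le, ← Real.exp_mul, expMart, ← Real.exp_add,
    mul_left_comm, ← Real.exp_add]
  congr 2
  ring

variable [IsProbabilityMeasure P]

/-- If `w (x, s)` lies between `a x^n - C x⁻¹` and `(a + ε) x^n + C_ε x⁻¹`, where `n` is a root of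
the characteristic equation and `-1` lies strictly between the roots, then the discounted
expectations along bounded stopping times tending to infinity converge to `a x^n`: the process
`e^{-rt} X_t^n` is a martingale, while `E[e^{-rτ} / X_τ]` tends to zero. -/
theorem tendsto_integral_discounted (hW : IsBrownianSetup P ℱ W) {μ σ r n a s₀ x C₀ : ℝ}
    (hn : σ ^ 2 * n ^ 2 / 2 + (μ - σ ^ 2 / 2) * n = r) (hδ : σ ^ 2 < r + μ) (hx : 0 < x)
    {w : ℝ → ℝ → ℝ} (hw : ContinuousOn (Function.uncurry w) stateSpace)
    (hlow : ∀ y s, 0 < y → y ≤ s → s₀ ≤ s → a * y ^ n - C₀ * y⁻¹ ≤ w y s)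
    (hup : ∀ ε, 0 < ε → ∃ C, ∀ y s, 0 < y → y ≤ s → s₀ ≤ s →
      w y s ≤ (a + ε) * y ^ n + C * y⁻¹)
    {τ : ℕ → Ω → ℝ≥0} (hτ : IsBoundedStoppingSeq P ℱ τ) :
    (∀ l, Integrable (discounted μ σ r w W x s₀ (τ l)) P) ∧
      Tendsto (fun l => ∫ ω, discounted μ σ r w W x s₀ (τ l) ω ∂P) atTop (𝓝 (a * x ^ n)) := by
  set δ := r + μ - σ ^ 2 with hδdef
  have hδ0 : 0 < δ := by linarith
  let M : ℕ → Ω → ℝ := fun l ω => x ^ n * expMart (n * σ) W (τ l ω) ω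
  let I : ℕ → Ω → ℝ := fun l ω =>
    x⁻¹ * (Real.exp (-δ * τ l ω) * expMart (-1 * σ) W (τ l ω) ω)
  have hM : ∀ l ω, Real.exp (-r * (τ l ω : ℝ)) * gbm μ σ W x (τ l ω) ω ^ n = M l ω := by
    intro l ω
    rw [discounted_gbm_rpow hx, hn]
    simp [M]
  have hI : ∀ l ω, Real.exp (-r * (τ l ω : ℝ)) * (gbm μ σ W x (τ l ω) ω)⁻¹ = I l ω := by
    intro l ω
    rw [← Real.rpow_neg_one, discounted_gbm_rpow hx, Real.rpow_neg_one]
    simp only [I, hδdef]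
    congr 4
    ring
  have hMi : ∀ l, Integrable (M l) P ∧ ∫ ω, M l ω ∂P = x ^ n := by
    intro l
    obtain ⟨C, hC⟩ := hτ.bounded l
    obtain ⟨h1, h2⟩ := integrable_expMart_stopped hW (n * σ) (hτ.stopping l) hC
    refine ⟨h1.const_mul _, ?_⟩
    simp only [M, integral_const_mul, h2, mul_one]
  have hIi : ∀ l, Integrable (I l) P := by
    intro l
    obtain ⟨C, hC⟩ := hτ.bounded l
    exact (discounted_expMart_le hW (-1 * σ) hδ0 (hτ.stopping l) hC 0 one_pos).1.const_mul _
  have hIlim : Tendsto (fun l => ∫ ω, I l ω ∂P) atTop (𝓝 0) := by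
    have h := (tendsto_discounted_expMart hW (-1 * σ) hδ0 hτ).const_mul x⁻¹
    simp only [I, integral_const_mul]
    simpa using h
  have hlow' : ∀ l, ∀ᵐ ω ∂P, a * M l ω - C₀ * I l ω ≤ discounted μ σ r w W x s₀ (τ l) ω := by
    intro l
    filter_upwards [hW.brownian.cont] with ω hω
    have h := mul_le_mul_of_nonneg_left (hlow _ _ (gbm_pos hx W (τ l ω) ω)
      (gbm_le_runMax hω _) (le_runMax μ σ x s₀ W (τ l ω) ω)) (Real.exp_pos (-r * (τ l ω : ℝ))).le
    rw [← hM, ← hI]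
    refine le_trans (le_of_eq ?_) h
    ring
  have hup' : ∀ ε, 0 < ε → ∃ C, ∀ l, ∀ᵐ ω ∂P,
      discounted μ σ r w W x s₀ (τ l) ω ≤ (a + ε) * M l ω + C * I l ω := by
    intro ε hε
    obtain ⟨C, hC⟩ := hup ε hε
    refine ⟨C, fun l => ?_⟩
    filter_upwards [hW.brownian.cont] with ω hω
    have h := mul_le_mul_of_nonneg_left (hC _ _ (gbm_pos hx W (τ l ω) ω)
      (gbm_le_runMax hω _) (le_runMax μ σ x s₀ W (τ l ω) ω)) (Real.exp_pos (-r * (τ l ω : ℝ))).le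
    rw [← hM, ← hI]
    refine le_trans h (le_of_eq ?_)
    ring
  have hlowi : ∀ l, Integrable (fun ω => a * M l ω - C₀ * I l ω) P := fun l =>
    ((hMi l).1.const_mul a).sub ((hIi l).const_mul C₀)
  have hupi : ∀ ε C l, Integrable (fun ω => (a + ε) * M l ω + C * I l ω) P := fun ε C l =>
    ((hMi l).1.const_mul (a + ε)).add ((hIi l).const_mul C)
  have hint : ∀ l, Integrable (discounted μ σ r w W x s₀ (τ l)) P := by
    intro l
    obtain ⟨C, hC⟩ := hup' 1 one_pos
    exact integrable_of_le_of_le (aestronglyMeasurable_discounted hW μ σ r hx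
      (measurable_of_isStoppingTime (hτ.stopping l)) hw) (hlow' l) (hC l) (hlowi l) (hupi 1 C l)
  refine ⟨hint, ?_⟩
  have hlowI : ∀ l, a * x ^ n - C₀ * ∫ ω, I l ω ∂P ≤
      ∫ ω, discounted μ σ r w W x s₀ (τ l) ω ∂P := by
    intro l
    have h := integral_mono_ae (hlowi l) (hint l) (hlow' l)
    rwa [integral_sub ((hMi l).1.const_mul a) ((hIi l).const_mul C₀), integral_const_mul _ (M l),
      (hMi l).2, integral_const_mul] at h
  have hlowT : Tendsto (fun l => a * x ^ n - C₀ * ∫ ω, I l ω ∂P) atTop (𝓝 (a * x ^ n)) := by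
    simpa using (tendsto_const_nhds (x := a * x ^ n)).sub (hIlim.const_mul C₀)
  have hxn : 0 < x ^ n := Real.rpow_pos_of_pos hx n
  refine tendsto_order.2 ⟨fun b hb => ?_, fun b hb => ?_⟩
  · filter_upwards [hlowT.eventually_const_lt hb] with l hl using hl.trans_le (hlowI l)
  · set ε := (b - a * x ^ n) / (2 * x ^ n) with hε
    have hε0 : 0 < ε := div_pos (sub_pos.2 hb) (by positivity)
    have hεx : (a + ε) * x ^ n < b := by
      have : ε * x ^ n = (b - a * x ^ n) / 2 := by rw [hε]; field_simp
      rw [add_mul, this]; linarith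
    obtain ⟨C, hC⟩ := hup' ε hε0
    have hT : Tendsto (fun l => (a + ε) * x ^ n + C * ∫ ω, I l ω ∂P) atTop
        (𝓝 ((a + ε) * x ^ n)) := by
      simpa using (tendsto_const_nhds (x := (a + ε) * x ^ n)).add (hIlim.const_mul C)
    filter_upwards [hT.eventually_lt_const hεx] with l hl
    refine lt_of_le_of_lt ?_ hl
    have h := integral_mono_ae (hint l) (hupi ε C l) (hC l)
    rwa [integral_add ((hMi l).1.const_mul _) ((hIi l).const_mul C), integral_const_mul _ (M l),
      (hMi l).2, integral_const_mul] at h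

end Limits

/-! ### The characteristic roots -/

section Roots

variable {μ σ r : ℝ}

lemma rootM_add_rootN (hσ : σ ≠ 0) : rootM μ σ r + rootN μ σ r = 1 - 2 * μ / σ ^ 2 := by
  unfold rootM rootN
  field_simp
  ring

lemma rootM_mul_rootN (hr : 0 < r) :
    rootM μ σ r * rootN μ σ r = -(2 * r / σ ^ 2) := by
  have h : 0 ≤ ((μ - σ ^ 2 / 2) / σ ^ 2) ^ 2 + 2 * r / σ ^ 2 := by positivity
  have hs := Real.sq_sqrt h
  unfold rootM rootN
  linear_combination -hs

lemma rootN_char (hσ : σ ≠ 0) (hr : 0 < r) :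
    σ ^ 2 * rootN μ σ r ^ 2 / 2 + (μ - σ ^ 2 / 2) * rootN μ σ r = r := by
  have h1 := rootM_add_rootN (μ := μ) (r := r) hσ
  have h2 := rootM_mul_rootN (μ := μ) (σ := σ) hr
  have e : rootM μ σ r = 1 - 2 * μ / σ ^ 2 - rootN μ σ r := by linarith
  rw [e] at h2
  field_simp at h2
  linarith

lemma rootM_char (hσ : σ ≠ 0) (hr : 0 < r) :
    σ ^ 2 * rootM μ σ r ^ 2 / 2 + (μ - σ ^ 2 / 2) * rootM μ σ r = r := by
  have h1 := rootM_add_rootN (μ := μ) (r := r) hσ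
  have h2 := rootM_mul_rootN (μ := μ) (σ := σ) hr
  have e : rootN μ σ r = 1 - 2 * μ / σ ^ 2 - rootM μ σ r := by linarith
  rw [e] at h2
  field_simp at h2
  linarith

lemma rootN_pos (hσ : σ ≠ 0) (hr : 0 < r) (hm : rootM μ σ r + 1 < 0) : 0 < rootN μ σ r := by
  have h2 := rootM_mul_rootN (μ := μ) (σ := σ) hr
  have h3 : 0 < 2 * r / σ ^ 2 := by positivity
  by_contra h
  nlinarith

lemma sq_lt_of_rootM (hσ : σ ≠ 0) (hr : 0 < r) (hm : rootM μ σ r + 1 < 0) : σ ^ 2 < r + μ := by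
  have h1 := rootM_add_rootN (μ := μ) (r := r) hσ
  have h2 := rootM_mul_rootN (μ := μ) (σ := σ) hr
  have hn := rootN_pos hσ hr hm
  have h3 : (rootM μ σ r + 1) * (rootN μ σ r + 1) < 0 := mul_neg_of_neg_of_pos hm (by linarith)
  have h4 : (rootM μ σ r + 1) * (rootN μ σ r + 1) = 2 * (σ ^ 2 - μ - r) / σ ^ 2 := by
    have : (rootM μ σ r + 1) * (rootN μ σ r + 1)
      = rootM μ σ r * rootN μ σ r + (rootM μ σ r + rootN μ σ r) + 1 := by ring
    rw [this, h1, h2]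
    field_simp; ring
  have h5 : 0 < σ ^ 2 := by positivity
  rw [h4, div_lt_iff₀ h5] at h3
  linarith

lemma GInf_eq (hσ : σ ≠ 0) (hr : 0 < r) : GInf μ σ r = (r + μ - σ ^ 2) / r := by
  have h1 := rootM_add_rootN (μ := μ) (r := r) hσ
  have h2 := rootM_mul_rootN (μ := μ) (σ := σ) hr
  have : (rootM μ σ r + 1) * (rootN μ σ r + 1)
      = rootM μ σ r * rootN μ σ r + (rootM μ σ r + rootN μ σ r) + 1 := by ring
  rw [GInf, this, h1, h2]
  field_simp; ring

lemma GInf_le_one (hσ : σ ≠ 0) (hr : 0 < r) (hm : rootM μ σ r + 1 < 0)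
    (hmn : 0 ≤ rootM μ σ r + rootN μ σ r + 1) : GInf μ σ r ≤ 1 := by
  have hn := rootN_pos hσ hr hm
  have h : rootM μ σ r * rootN μ σ r < 0 := mul_neg_of_neg_of_pos (by linarith) hn
  rw [GInf, div_le_one_of_neg h]
  linarith

lemma rootM_mul_rootN_mul_G (hσ : σ ≠ 0) (hr : 0 < r) (hm : rootM μ σ r + 1 < 0) (s : ℝ) :
    rootM μ σ r * rootN μ σ r * G μ σ r s = (rootM μ σ r + 1) * (rootN μ σ r + 1) * F s := by
  have hn := rootN_pos hσ hr hm
  have hm0 : rootM μ σ r ≠ 0 := by linarith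
  rw [G, GInf]
  field_simp

end Roots

/-! ### The function `F` -/

lemma hasDerivAt_F (s : ℝ) : HasDerivAt F (Real.exp (-s)) s := by
  have h := ((Real.hasDerivAt_exp (-s)).comp s (hasDerivAt_neg s)).const_sub 1
  rw [show F = fun s => 1 - Real.exp (-s) from rfl]
  simpa [Function.comp_def] using h

lemma contDiff_F {k : WithTop ℕ∞} : ContDiff ℝ k F := by
  unfold F
  fun_prop

lemma F_pos {s : ℝ} (hs : 0 < s) : 0 < F s := by
  have : Real.exp (-s) < 1 := by
    rw [← Real.exp_zero]; exact Real.exp_lt_exp.2 (by linarith)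
  unfold F; linarith

lemma F_lt_one (s : ℝ) : F s < 1 := by
  have := Real.exp_pos (-s)
  unfold F; linarith

lemma F_lt_self {s : ℝ} (hs : 0 < s) : F s < s := by
  have := Real.add_one_lt_exp (x := -s) (by linarith)
  unfold F; linarith

lemma tendsto_F : Tendsto F atTop (𝓝 1) := by
  have := (Real.tendsto_exp_atBot.comp tendsto_neg_atTop_atBot).const_sub (1 : ℝ)
  rw [show F = fun s => 1 - Real.exp (-s) from rfl]
  simpa [Function.comp_def] using this

/-! ### The free boundary and the coefficients of the candidate -/

namespace IsFreeBoundary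

variable {μ σ r Hinf : ℝ} {H : ℝ → ℝ}

lemma strictMonoOn (hH : IsFreeBoundary μ σ r Hinf H) : StrictMonoOn H (Ioi 0) := by
  refine strictMonoOn_of_deriv_pos (convex_Ioi 0)
    (fun s hs => (hH.ode s hs).continuousAt.continuousWithinAt) ?_
  rw [interior_Ioi]
  exact fun s hs => hH.deriv_pos s hs

lemma lt_Hinf (hH : IsFreeBoundary μ σ r Hinf H) {s : ℝ} (hs : 0 < s) : H s < Hinf := by
  have h1 : H s < H (s + 1) := hH.strictMonoOn hs (show 0 < s + 1 by linarith) (by linarith)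
  refine h1.trans_le (ge_of_tendsto hH.tendsto_top ?_)
  filter_upwards [eventually_ge_atTop (s + 1)] with t ht
  exact hH.strictMonoOn.monotoneOn (show 0 < s + 1 by linarith) (show 0 < t by linarith) ht

lemma lt_F (hσ : σ ≠ 0) (hr : 0 < r) (hm : rootM μ σ r + 1 < 0)
    (hmn : 0 ≤ rootM μ σ r + rootN μ σ r + 1) (hH : IsFreeBoundary μ σ r Hinf H)
    {s : ℝ} (hs : 0 < s) : H s < F s := by
  refine (hH.lt_G s hs).trans_le ?_
  exact mul_le_of_le_one_left (F_pos hs).le (GInf_le_one hσ hr hm hmn)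

lemma lt_self (hσ : σ ≠ 0) (hr : 0 < r) (hm : rootM μ σ r + 1 < 0)
    (hmn : 0 ≤ rootM μ σ r + rootN μ σ r + 1) (hH : IsFreeBoundary μ σ r Hinf H)
    {s : ℝ} (hs : 0 < s) : H s < s :=
  (hH.lt_F hσ hr hm hmn hs).trans (F_lt_self hs)

lemma ratio_mem (hσ : σ ≠ 0) (hr : 0 < r) (hm : rootM μ σ r + 1 < 0)
    (hmn : 0 ≤ rootM μ σ r + rootN μ σ r + 1) (hH : IsFreeBoundary μ σ r Hinf H)
    {s : ℝ} (hs : 0 < s) :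
    0 < (H s / s) ^ (rootN μ σ r - rootM μ σ r) ∧
      (H s / s) ^ (rootN μ σ r - rootM μ σ r) < 1 := by
  have hn := rootN_pos hσ hr hm
  have h1 : 0 < H s / s := div_pos (hH.pos s hs) hs
  have h2 : H s / s < 1 := (div_lt_one hs).2 (hH.lt_self hσ hr hm hmn hs)
  exact ⟨Real.rpow_pos_of_pos h1 _, Real.rpow_lt_one h1.le h2 (by linarith)⟩

lemma continuousAt (hH : IsFreeBoundary μ σ r Hinf H) {s : ℝ} (hs : 0 < s) : ContinuousAt H s :=
  (hH.ode s hs).continuousAt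

/-- The free boundary is twice continuously differentiable, since the right-hand side of its
equation is smooth along it. -/
lemma contDiffOn_two (hσ : σ ≠ 0) (hr : 0 < r) (hm : rootM μ σ r + 1 < 0)
    (hmn : 0 ≤ rootM μ σ r + rootN μ σ r + 1) (hH : IsFreeBoundary μ σ r Hinf H) :
    ContDiffOn ℝ 2 H (Ioi 0) := by
  have hn := rootN_pos hσ hr hm
  have hdiff : DifferentiableOn ℝ H (Ioi 0) := fun s hs =>
    (hH.ode s hs).differentiableAt.differentiableWithinAt
  have hstep : ∀ k : WithTop ℕ∞, ContDiffOn ℝ k H (Ioi 0) → ContDiffOn ℝ k (deriv H) (Ioi 0) := by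
    intro k hk
    have hrhs : ContDiffOn ℝ k (fun s => odeRhs μ σ r s (H s)) (Ioi 0) := by
      have hρ : ContDiffOn ℝ k
          (fun s => (H s / s) ^ (rootN μ σ r - rootM μ σ r)) (Ioi 0) := by
        refine (hk.div contDiffOn_id fun s hs => ne_of_gt hs).rpow_const_of_ne fun s hs => ?_
        exact (div_pos (hH.pos s hs) hs).ne'
      have hexp : ContDiffOn ℝ k (fun s : ℝ => Real.exp (-s)) (Ioi 0) := by fun_prop
      have hG : ContDiffOn ℝ k (G μ σ r) (Ioi 0) := (contDiff_const.mul contDiff_F).contDiffOn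
      unfold odeRhs
      refine ((hexp.mul ((contDiffOn_const.mul hρ).sub contDiffOn_const)).mul hk).div
        ((contDiffOn_const.mul (hG.sub hk)).mul (contDiffOn_const.sub hρ)) fun s hs => ?_
      have h1 : rootM μ σ r * rootN μ σ r < 0 := mul_neg_of_neg_of_pos (by linarith) hn
      have h2 := hH.lt_G s hs
      have h3 := (hH.ratio_mem hσ hr hm hmn hs).2
      exact mul_ne_zero (mul_ne_zero (by linarith) (by linarith)) (by linarith)
    exact hrhs.congr fun s hs => (hH.ode s hs).deriv
  have h0 : ContDiffOn ℝ 0 H (Ioi 0) := contDiffOn_zero.2 hdiff.continuousOn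
  have h1 : ContDiffOn ℝ 1 H (Ioi 0) := by
    rw [show (1 : WithTop ℕ∞) = 0 + 1 by norm_num, contDiffOn_succ_iff_deriv_of_isOpen isOpen_Ioi]
    exact ⟨hdiff, by simp, hstep 0 h0⟩
  rw [show (2 : WithTop ℕ∞) = 1 + 1 by norm_num, contDiffOn_succ_iff_deriv_of_isOpen isOpen_Ioi]
  exact ⟨hdiff, by simp, hstep 1 h1⟩

lemma coefA_mul (hH : IsFreeBoundary μ σ r Hinf H) {s : ℝ} (hs : 0 < s) :
    coefA μ σ r H s * H s ^ (rootN μ σ r + 1) =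
      (rootM μ σ r * H s - (rootM μ σ r + 1) * F s) / (rootN μ σ r - rootM μ σ r) := by
  have := (Real.rpow_pos_of_pos (hH.pos s hs) (rootN μ σ r + 1)).ne'
  rw [coefA, div_mul_eq_mul_div, mul_div_mul_right _ _ this]

lemma coefB_mul (hH : IsFreeBoundary μ σ r Hinf H) {s : ℝ} (hs : 0 < s) :
    coefB μ σ r H s * H s ^ (rootM μ σ r + 1) =
      ((rootN μ σ r + 1) * F s - rootN μ σ r * H s) / (rootN μ σ r - rootM μ σ r) := by
  have := (Real.rpow_pos_of_pos (hH.pos s hs) (rootM μ σ r + 1)).ne'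
  rw [coefB, div_mul_eq_mul_div, mul_div_mul_right _ _ this]

/-- The common form of the derivatives of the two coefficients, which are exchanged, up to a sign,
by swapping the roots. -/
lemma hasDerivAt_coef {h' s : ℝ} (hs : 0 < H s) (hd : HasDerivAt H h' s) (k l : ℝ) :
    HasDerivAt (fun t => (k * H t - (k + 1) * F t) / ((l - k) * H t ^ (l + 1)))
      ((((k + 1) * (l + 1) * F s - k * l * H s) * h' - (k + 1) * Real.exp (-s) * H s) /
        ((l - k) * H s ^ (l + 1) * H s)) s := by
  by_cases hkl : l - k = 0
  · simpa [hkl] using hasDerivAt_const s (0 : ℝ)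
  have hp := Real.rpow_pos_of_pos hs l
  have hpow : H s ^ (l + 1) = H s ^ l * H s := by rw [Real.rpow_add hs, Real.rpow_one]
  have h1 := (hd.const_mul k).sub ((hasDerivAt_F s).const_mul (k + 1))
  have h2 := (hd.rpow_const (p := l + 1) (Or.inl hs.ne')).const_mul (l - k)
  have hne : (l - k) * H s ^ (l + 1) ≠ 0 := by
    rw [hpow]
    exact mul_ne_zero hkl (mul_pos hp hs).ne'
  refine (h1.div h2 hne).congr_deriv ?_
  rw [add_sub_cancel_right, hpow, Pi.sub_apply]
  field_simp
  ring

/-- The free-boundary equation, solved for the combination `m n (G - H) H'` that occurs in the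
derivatives of both coefficients. -/
lemma ode_mul (hσ : σ ≠ 0) (hr : 0 < r) (hm : rootM μ σ r + 1 < 0)
    (hmn : 0 ≤ rootM μ σ r + rootN μ σ r + 1) (hH : IsFreeBoundary μ σ r Hinf H)
    {s : ℝ} (hs : 0 < s) :
    ((rootM μ σ r + 1) * (rootN μ σ r + 1) * F s - rootM μ σ r * rootN μ σ r * H s) *
        odeRhs μ σ r s (H s) =
      -(Real.exp (-s) * ((rootN μ σ r + 1) * (H s / s) ^ (rootN μ σ r - rootM μ σ r)
        - (rootM μ σ r + 1)) * H s / (1 - (H s / s) ^ (rootN μ σ r - rootM μ σ r))) := by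
  have hn := rootN_pos hσ hr hm
  rw [← rootM_mul_rootN_mul_G hσ hr hm, odeRhs]
  have h1 : rootM μ σ r ≠ 0 := by linarith
  have h2 : G μ σ r s - H s ≠ 0 := (sub_pos.2 (hH.lt_G s hs)).ne'
  have h3 : 1 - (H s / s) ^ (rootN μ σ r - rootM μ σ r) ≠ 0 :=
    (sub_pos.2 (hH.ratio_mem hσ hr hm hmn hs).2).ne'
  generalize (H s / s) ^ (rootN μ σ r - rootM μ σ r) = ρ at *
  field_simp

lemma hasDerivAt_coefA (hσ : σ ≠ 0) (hr : 0 < r) (hm : rootM μ σ r + 1 < 0)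
    (hmn : 0 ≤ rootM μ σ r + rootN μ σ r + 1) (hH : IsFreeBoundary μ σ r Hinf H)
    {s : ℝ} (hs : 0 < s) :
    HasDerivAt (coefA μ σ r H)
      (-(Real.exp (-s) * (H s / s) ^ (rootN μ σ r - rootM μ σ r) /
        (1 - (H s / s) ^ (rootN μ σ r - rootM μ σ r)) / H s ^ (rootN μ σ r + 1))) s := by
  have hn := rootN_pos hσ hr hm
  have hp := hH.pos s hs
  refine (hasDerivAt_coef hp (hH.ode s hs) (rootM μ σ r) (rootN μ σ r)).congr_deriv ?_
  rw [hH.ode_mul hσ hr hm hmn hs]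
  have h1 : rootN μ σ r - rootM μ σ r ≠ 0 := by linarith
  have h3 : 1 - (H s / s) ^ (rootN μ σ r - rootM μ σ r) ≠ 0 :=
    (sub_pos.2 (hH.ratio_mem hσ hr hm hmn hs).2).ne'
  have h4 := (Real.rpow_pos_of_pos hp (rootN μ σ r + 1)).ne'
  generalize (H s / s) ^ (rootN μ σ r - rootM μ σ r) = ρ at *
  generalize H s ^ (rootN μ σ r + 1) = q at *
  field_simp
  ring

lemma hasDerivAt_coefB (hσ : σ ≠ 0) (hr : 0 < r) (hm : rootM μ σ r + 1 < 0)
    (hmn : 0 ≤ rootM μ σ r + rootN μ σ r + 1) (hH : IsFreeBoundary μ σ r Hinf H)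
    {s : ℝ} (hs : 0 < s) :
    HasDerivAt (coefB μ σ r H)
      (Real.exp (-s) / (1 - (H s / s) ^ (rootN μ σ r - rootM μ σ r)) /
        H s ^ (rootM μ σ r + 1)) s := by
  have hn := rootN_pos hσ hr hm
  have hp := hH.pos s hs
  have h1 : rootN μ σ r - rootM μ σ r ≠ 0 := by linarith
  have h1' : rootM μ σ r - rootN μ σ r ≠ 0 := by linarith
  have hfun : coefB μ σ r H = fun t => (rootN μ σ r * H t - (rootN μ σ r + 1) * F t) /
      ((rootM μ σ r - rootN μ σ r) * H t ^ (rootM μ σ r + 1)) := by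
    ext t
    rw [coefB, ← neg_div_neg_eq]
    congr 1 <;> ring
  rw [hfun]
  refine (hasDerivAt_coef hp (hH.ode s hs) (rootN μ σ r) (rootM μ σ r)).congr_deriv ?_
  have hode := hH.ode_mul hσ hr hm hmn hs
  rw [mul_comm (rootM μ σ r + 1), mul_comm (rootM μ σ r) (rootN μ σ r)] at hode
  rw [hode]
  have h3 : 1 - (H s / s) ^ (rootN μ σ r - rootM μ σ r) ≠ 0 :=
    (sub_pos.2 (hH.ratio_mem hσ hr hm hmn hs).2).ne'
  have h4 := (Real.rpow_pos_of_pos hp (rootM μ σ r + 1)).ne'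
  generalize (H s / s) ^ (rootN μ σ r - rootM μ σ r) = ρ at *
  generalize H s ^ (rootM μ σ r + 1) = q at *
  field_simp
  ring

/-- Since `A` decreases, a nonnegative limit at infinity makes it positive everywhere. -/
lemma strictAntiOn_coefA (hσ : σ ≠ 0) (hr : 0 < r) (hm : rootM μ σ r + 1 < 0)
    (hmn : 0 ≤ rootM μ σ r + rootN μ σ r + 1) (hH : IsFreeBoundary μ σ r Hinf H) :
    StrictAntiOn (coefA μ σ r H) (Ioi 0) := by
  refine strictAntiOn_of_deriv_neg (convex_Ioi 0) (fun s hs =>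
    (hH.hasDerivAt_coefA hσ hr hm hmn hs).continuousAt.continuousWithinAt) ?_
  rw [interior_Ioi]
  intro s hs
  rw [(hH.hasDerivAt_coefA hσ hr hm hmn hs).deriv]
  obtain ⟨h1, h2⟩ := hH.ratio_mem hσ hr hm hmn hs
  have h3 := Real.rpow_pos_of_pos (hH.pos s hs) (rootN μ σ r + 1)
  have h4 := sub_pos.2 h2
  have h5 := Real.exp_pos (-s)
  exact neg_neg_of_pos (by positivity)

end IsFreeBoundary

/-- The limit of `coefA` at infinity, as a function of the limit of the free boundary. -/
def limA (μ σ r Hinf : ℝ) : ℝ :=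
  (rootM μ σ r * Hinf - (rootM μ σ r + 1)) /
    ((rootN μ σ r - rootM μ σ r) * Hinf ^ (rootN μ σ r + 1))

section LimA

variable {μ σ r Hinf : ℝ}

/-- Since `m < 0`, the limit of `A` has the sign of `H_∞° - H_∞`. -/
lemma limA_eq (hm : rootM μ σ r + 1 < 0) :
    limA μ σ r Hinf = rootM μ σ r * (Hinf - HCrit μ σ r) /
      ((rootN μ σ r - rootM μ σ r) * Hinf ^ (rootN μ σ r + 1)) := by
  have : rootM μ σ r ≠ 0 := by linarith
  rw [limA, HCrit]
  congr 1
  field_simp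

lemma limA_pos (hσ : σ ≠ 0) (hr : 0 < r) (hm : rootM μ σ r + 1 < 0) (hH₀ : 0 < Hinf)
    (h : Hinf < HCrit μ σ r) : 0 < limA μ σ r Hinf := by
  have hn := rootN_pos hσ hr hm
  rw [limA_eq hm]
  exact div_pos (mul_pos_of_neg_of_neg (by linarith) (by linarith))
    (mul_pos (by linarith) (Real.rpow_pos_of_pos hH₀ _))

lemma limA_neg (hσ : σ ≠ 0) (hr : 0 < r) (hm : rootM μ σ r + 1 < 0) (hH₀ : 0 < Hinf)
    (h : HCrit μ σ r < Hinf) : limA μ σ r Hinf < 0 := by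
  have hn := rootN_pos hσ hr hm
  rw [limA_eq hm]
  exact div_neg_of_neg_of_pos (mul_neg_of_neg_of_pos (by linarith) (by linarith))
    (mul_pos (by linarith) (Real.rpow_pos_of_pos hH₀ _))

lemma limA_crit (hm : rootM μ σ r + 1 < 0) : limA μ σ r (HCrit μ σ r) = 0 := by
  rw [limA_eq hm]; simp

lemma limA_nonneg (hσ : σ ≠ 0) (hr : 0 < r) (hm : rootM μ σ r + 1 < 0) (hH₀ : 0 < Hinf)
    (h : Hinf ≤ HCrit μ σ r) : 0 ≤ limA μ σ r Hinf := by
  rcases h.lt_or_eq with h | h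
  · exact (limA_pos hσ hr hm hH₀ h).le
  · rw [h, limA_crit hm]

end LimA

namespace IsFreeBoundary

variable {μ σ r Hinf : ℝ} {H : ℝ → ℝ}

lemma tendsto_coefA (hσ : σ ≠ 0) (hr : 0 < r) (hm : rootM μ σ r + 1 < 0) (hH₀ : 0 < Hinf)
    (hH : IsFreeBoundary μ σ r Hinf H) :
    Tendsto (coefA μ σ r H) atTop (𝓝 (limA μ σ r Hinf)) := by
  have hn := rootN_pos hσ hr hm
  have h1 := (hH.tendsto_top.const_mul (rootM μ σ r)).sub (tendsto_F.const_mul (rootM μ σ r + 1))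
  have h2 := (hH.tendsto_top.rpow_const (p := rootN μ σ r + 1) (Or.inl hH₀.ne')).const_mul
    (rootN μ σ r - rootM μ σ r)
  have h3 := h1.div h2 (mul_pos (by linarith) (Real.rpow_pos_of_pos hH₀ _)).ne'
  rw [mul_one] at h3
  exact h3

lemma limA_lt_coefA (hσ : σ ≠ 0) (hr : 0 < r) (hm : rootM μ σ r + 1 < 0)
    (hmn : 0 ≤ rootM μ σ r + rootN μ σ r + 1) (hH₀ : 0 < Hinf)
    (hH : IsFreeBoundary μ σ r Hinf H) {s : ℝ} (hs : 0 < s) :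
    limA μ σ r Hinf < coefA μ σ r H s := by
  have hA := hH.strictAntiOn_coefA hσ hr hm hmn
  have h1 : coefA μ σ r H (s + 1) < coefA μ σ r H s :=
    hA hs (show 0 < s + 1 by linarith) (by linarith)
  refine lt_of_le_of_lt (le_of_tendsto (hH.tendsto_coefA hσ hr hm hH₀) ?_) h1
  filter_upwards [eventually_ge_atTop (s + 1)] with t ht
  exact hA.antitoneOn (show 0 < s + 1 by linarith) (show 0 < t by linarith) ht

lemma coefB_pos (hσ : σ ≠ 0) (hr : 0 < r) (hm : rootM μ σ r + 1 < 0)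
    (hmn : 0 ≤ rootM μ σ r + rootN μ σ r + 1)
    (hH : IsFreeBoundary μ σ r Hinf H) {s : ℝ} (hs : 0 < s) : 0 < coefB μ σ r H s := by
  have hn := rootN_pos hσ hr hm
  have h1 := hH.lt_F hσ hr hm hmn hs
  have h2 := F_pos hs
  refine div_pos ?_ (mul_pos (by linarith) (Real.rpow_pos_of_pos (hH.pos s hs) _))
  nlinarith

end IsFreeBoundary

/-! ### Gluing differentiable functions -/

open Classical in
/-- A function glued from two functions along the zero set of `c` is differentiable where the two
pieces match to first order. -/
lemma hasFDerivAt_ite {E : Type*} [NormedAddCommGroup E] [NormedSpace ℝ E] {f g c : E → ℝ}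
    {f' g' : E →L[ℝ] ℝ} {p : E} (hc : ContinuousAt c p) (hf : HasFDerivAt f f' p)
    (hg : HasFDerivAt g g' p) (h0 : c p = 0 → f p = g p ∧ f' = g') :
    HasFDerivAt (fun q => if c q ≤ 0 then f q else g q) (if c p ≤ 0 then f' else g') p := by
  rcases lt_trichotomy (c p) 0 with h | h | h
  · rw [if_pos h.le]
    refine hf.congr_of_eventuallyEq ?_
    filter_upwards [hc.eventually_lt_const h] with q hq using if_pos hq.le
  · obtain ⟨e1, e2⟩ := h0 h
    rw [if_pos h.le]
    have h1 : HasFDerivWithinAt (fun q => if c q ≤ 0 then f q else g q) f' {q | c q ≤ 0} p :=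
      hf.hasFDerivWithinAt.congr (fun q hq => if_pos hq) (if_pos h.le)
    have h2 : HasFDerivWithinAt (fun q => if c q ≤ 0 then f q else g q) f' {q | c q ≤ 0}ᶜ p := by
      rw [e2]
      exact hg.hasFDerivWithinAt.congr (fun q hq => if_neg hq) (by rw [if_pos h.le, e1])
    have h3 := h1.union h2
    rwa [union_compl_self, hasFDerivWithinAt_univ] at h3
  · rw [if_neg h.not_ge]
    refine hg.congr_of_eventuallyEq ?_
    filter_upwards [hc.eventually_const_lt h] with q hq using if_neg hq.not_ge

open Classical in
lemma hasDerivAt_ite {f g c : ℝ → ℝ} {f' g' x : ℝ} (hc : ContinuousAt c x)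
    (hf : HasDerivAt f f' x) (hg : HasDerivAt g g' x) (h0 : c x = 0 → f x = g x ∧ f' = g') :
    HasDerivAt (fun y => if c y ≤ 0 then f y else g y) (if c x ≤ 0 then f' else g') x := by
  have h := hasFDerivAt_ite hc hf.hasFDerivAt hg.hasFDerivAt fun h => by
    obtain ⟨e1, e2⟩ := h0 h
    exact ⟨e1, by rw [e2]⟩
  by_cases hx : c x ≤ 0
  · rw [if_pos hx] at h ⊢
    exact hasDerivAt_iff_hasFDerivAt.2 h
  · rw [if_neg hx] at h ⊢
    exact hasDerivAt_iff_hasFDerivAt.2 h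

open Classical in
lemma contDiffOn_one_ite {E : Type*} [NormedAddCommGroup E] [NormedSpace ℝ E] {f g c : E → ℝ}
    {U : Set E} (hU : IsOpen U) (hc : ContinuousOn c U) (hf : ContDiffOn ℝ 1 f U)
    (hg : ContDiffOn ℝ 1 g U)
    (h0 : ∀ p ∈ U, c p = 0 → f p = g p ∧ fderiv ℝ f p = fderiv ℝ g p) :
    ContDiffOn ℝ 1 (fun q => if c q ≤ 0 then f q else g q) U := by
  rw [show (1 : WithTop ℕ∞) = 0 + 1 by norm_num, contDiffOn_succ_iff_fderiv_of_isOpen hU] at hf hg ⊢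
  obtain ⟨hfd, -, hfc⟩ := hf
  obtain ⟨hgd, -, hgc⟩ := hg
  rw [contDiffOn_zero] at hfc hgc
  have hd : ∀ p ∈ U, HasFDerivAt (fun q => if c q ≤ 0 then f q else g q)
      (if c p ≤ 0 then fderiv ℝ f p else fderiv ℝ g p) p := fun p hp =>
    hasFDerivAt_ite (hc.continuousAt (hU.mem_nhds hp))
      (hfd.differentiableAt (hU.mem_nhds hp)).hasFDerivAt
      (hgd.differentiableAt (hU.mem_nhds hp)).hasFDerivAt (h0 p hp)
  refine ⟨fun p hp => (hd p hp).differentiableAt.differentiableWithinAt, by simp, ?_⟩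
  rw [contDiffOn_zero]
  have hcont : ContinuousOn
      (fun p => if c p ≤ 0 then fderiv ℝ f p else fderiv ℝ g p) U := by
    intro p hp
    have hU' := hU.mem_nhds hp
    have hcp := hc.continuousAt hU'
    have hfp := hfc.continuousAt hU'
    have hgp := hgc.continuousAt hU'
    refine ContinuousAt.continuousWithinAt ?_
    rcases lt_trichotomy (c p) 0 with h | h | h
    · refine hfp.congr ?_
      filter_upwards [hcp.eventually_lt_const h] with q hq using (if_pos hq.le).symm
    · have e := (h0 p hp h).2
      refine Filter.Tendsto.if' ?_ ?_
      · simpa only [if_pos h.le] using hfp.tendsto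
      · simpa only [if_pos h.le, e] using hgp.tendsto
    · refine hgp.congr ?_
      filter_upwards [hcp.eventually_const_lt h] with q hq using (if_neg hq.not_ge).symm
  exact hcont.congr fun p hp => (hd p hp).fderiv

/-! ### Regularity of the candidate -/

/-- The expression for the candidate in the continuation region, extended to the quadrant. -/
def upper (μ σ r : ℝ) (H : ℝ → ℝ) (x s : ℝ) : ℝ :=
  coefA μ σ r H s * x ^ rootN μ σ r + coefB μ σ r H s * x ^ rootM μ σ r

/-- The expression for the candidate in the stopping region, extended to the quadrant. -/
def lower (x s : ℝ) : ℝ := x⁻¹ * F s - 1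

/-- The derivative of `upper` in `x`. -/
def upperX (μ σ r : ℝ) (H : ℝ → ℝ) (x s : ℝ) : ℝ :=
  coefA μ σ r H s * (rootN μ σ r * x ^ (rootN μ σ r - 1)) +
    coefB μ σ r H s * (rootM μ σ r * x ^ (rootM μ σ r - 1))

/-- The second derivative of `upper` in `x`. -/
def upperXX (μ σ r : ℝ) (H : ℝ → ℝ) (x s : ℝ) : ℝ :=
  coefA μ σ r H s * (rootN μ σ r * ((rootN μ σ r - 1) * x ^ (rootN μ σ r - 1 - 1))) +
    coefB μ σ r H s * (rootM μ σ r * ((rootM μ σ r - 1) * x ^ (rootM μ σ r - 1 - 1)))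

section Pieces

variable {μ σ r Hinf : ℝ} {H : ℝ → ℝ} {x s : ℝ}

lemma hasDerivAt_upper (hx : 0 < x) :
    HasDerivAt (fun y => upper μ σ r H y s) (upperX μ σ r H x s) x :=
  ((Real.hasDerivAt_rpow_const (Or.inl hx.ne')).const_mul _).add
    ((Real.hasDerivAt_rpow_const (Or.inl hx.ne')).const_mul _)

lemma hasDerivAt_upperX (hx : 0 < x) :
    HasDerivAt (fun y => upperX μ σ r H y s) (upperXX μ σ r H x s) x :=
  (((Real.hasDerivAt_rpow_const (Or.inl hx.ne')).const_mul _).const_mul _).add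
    (((Real.hasDerivAt_rpow_const (Or.inl hx.ne')).const_mul _).const_mul _)

lemma hasDerivAt_lower (hx : 0 < x) : HasDerivAt (fun y => lower y s) (-F s / x ^ 2) x := by
  refine (((hasDerivAt_inv hx.ne').mul_const (F s)).sub_const 1).congr_deriv ?_
  ring

lemma hasDerivAt_lowerX (hx : 0 < x) :
    HasDerivAt (fun y => -F s / y ^ 2) (2 * F s / x ^ 3) x := by
  refine ((hasDerivAt_const x (-F s)).div (hasDerivAt_pow 2 x) (by positivity)).congr_deriv ?_
  field_simp
  ring

lemma cand_of_le (h : x ≤ H s) : cand μ σ r H x s = lower x s := if_pos h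

lemma cand_of_lt (h : H s < x) : cand μ σ r H x s = upper μ σ r H x s := if_neg h.not_ge

namespace IsFreeBoundary

/-- Continuous fit at the free boundary. -/
lemma upper_eq_lower (hσ : σ ≠ 0) (hr : 0 < r) (hm : rootM μ σ r + 1 < 0)
    (hH : IsFreeBoundary μ σ r Hinf H) (hs : 0 < s) :
    upper μ σ r H (H s) s = lower (H s) s := by
  have hn := rootN_pos hσ hr hm
  have hp := hH.pos s hs
  have hA := hH.coefA_mul hs
  have hB := hH.coefB_mul hs
  rw [Real.rpow_add hp, Real.rpow_one, ← mul_assoc] at hA hB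
  have hnm : rootN μ σ r - rootM μ σ r ≠ 0 := by linarith
  have h : upper μ σ r H (H s) s * H s = F s - H s := by
    rw [upper, add_mul, hA, hB]
    field_simp
    ring
  rw [eq_div_of_mul_eq hp.ne' h, lower]
  field_simp

/-- Smooth fit at the free boundary. -/
lemma upperX_eq (hσ : σ ≠ 0) (hr : 0 < r) (hm : rootM μ σ r + 1 < 0)
    (hH : IsFreeBoundary μ σ r Hinf H) (hs : 0 < s) :
    upperX μ σ r H (H s) s = -F s / H s ^ 2 := by
  have hn := rootN_pos hσ hr hm
  have hp := hH.pos s hs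
  have hA := hH.coefA_mul hs
  have hB := hH.coefB_mul hs
  have e : ∀ k : ℝ, H s ^ (k + 1) = H s ^ (k - 1) * H s ^ 2 := fun k => by
    rw [← Real.rpow_natCast (H s) 2, ← Real.rpow_add hp]
    congr 1; push_cast; ring
  rw [e] at hA hB
  have hnm : rootN μ σ r - rootM μ σ r ≠ 0 := by linarith
  rw [eq_div_iff (by positivity)]
  have h : upperX μ σ r H (H s) s * H s ^ 2 =
      rootN μ σ r * (coefA μ σ r H s * (H s ^ (rootN μ σ r - 1) * H s ^ 2)) +
      rootM μ σ r * (coefB μ σ r H s * (H s ^ (rootM μ σ r - 1) * H s ^ 2)) := by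
    rw [upperX]; ring
  rw [h, hA, hB]
  field_simp
  ring

/-- The derivative of `upper` in the second variable. -/
lemma hasDerivAt_upper_snd (hσ : σ ≠ 0) (hr : 0 < r) (hm : rootM μ σ r + 1 < 0)
    (hmn : 0 ≤ rootM μ σ r + rootN μ σ r + 1) (hH : IsFreeBoundary μ σ r Hinf H)
    (hx : 0 < x) (hs : 0 < s) :
    HasDerivAt (fun u => upper μ σ r H x u)
      (Real.exp (-s) / (1 - (H s / s) ^ (rootN μ σ r - rootM μ σ r)) / H s *
        ((x / H s) ^ rootM μ σ r -
          (H s / s) ^ (rootN μ σ r - rootM μ σ r) * (x / H s) ^ rootN μ σ r)) s := by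
  have hp := hH.pos s hs
  refine (((hH.hasDerivAt_coefA hσ hr hm hmn hs).mul_const (x ^ rootN μ σ r)).add
    ((hH.hasDerivAt_coefB hσ hr hm hmn hs).mul_const (x ^ rootM μ σ r))).congr_deriv ?_
  rw [Real.div_rpow hx.le hp.le, Real.div_rpow hx.le hp.le, Real.rpow_add hp, Real.rpow_add hp,
    Real.rpow_one]
  have h3 : 1 - (H s / s) ^ (rootN μ σ r - rootM μ σ r) ≠ 0 :=
    (sub_pos.2 (hH.ratio_mem hσ hr hm hmn hs).2).ne'
  have h4 := (Real.rpow_pos_of_pos hp (rootM μ σ r)).ne'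
  have h5 := (Real.rpow_pos_of_pos hp (rootN μ σ r)).ne'
  generalize (H s / s) ^ (rootN μ σ r - rootM μ σ r) = ρ at *
  generalize H s ^ (rootM μ σ r) = p at *
  generalize H s ^ (rootN μ σ r) = q at *
  field_simp
  ring

end IsFreeBoundary

end Pieces

/-- The open quadrant. -/
def quadrant : Set (ℝ × ℝ) := {p | 0 < p.1 ∧ 0 < p.2}

lemma isOpen_quadrant : IsOpen quadrant :=
  (isOpen_lt continuous_const continuous_fst).inter (isOpen_lt continuous_const continuous_snd)

lemma stateSpace_subset_quadrant : stateSpace ⊆ quadrant := fun _ hp => ⟨hp.1, hp.1.trans_le hp.2⟩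

lemma contDiffOn_lower {k : WithTop ℕ∞} : ContDiffOn ℝ k (Function.uncurry lower) quadrant := by
  have h1 : ContDiffOn ℝ k (fun p : ℝ × ℝ => p.1⁻¹) quadrant :=
    contDiff_fst.contDiffOn.inv fun p hp => hp.1.ne'
  exact (h1.mul (contDiff_F.comp contDiff_snd).contDiffOn).sub contDiffOn_const

namespace IsFreeBoundary

variable {μ σ r Hinf : ℝ} {H : ℝ → ℝ}

lemma contDiffOn_coef (hσ : σ ≠ 0) (hr : 0 < r) (hm : rootM μ σ r + 1 < 0)
    (hmn : 0 ≤ rootM μ σ r + rootN μ σ r + 1) (hH : IsFreeBoundary μ σ r Hinf H) :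
    ContDiffOn ℝ 2 (coefA μ σ r H) (Ioi 0) ∧ ContDiffOn ℝ 2 (coefB μ σ r H) (Ioi 0) := by
  have hn := rootN_pos hσ hr hm
  have hnm : rootN μ σ r - rootM μ σ r ≠ 0 := by linarith
  have h2 := hH.contDiffOn_two hσ hr hm hmn
  have hF : ContDiffOn ℝ 2 F (Ioi 0) := contDiff_F.contDiffOn
  have hpow : ∀ k : ℝ, ContDiffOn ℝ 2
      (fun s => (rootN μ σ r - rootM μ σ r) * H s ^ k) (Ioi 0) := fun k =>
    contDiffOn_const.mul (h2.rpow_const_of_ne fun s hs => (hH.pos s hs).ne')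
  have hne : ∀ k : ℝ, ∀ s ∈ Ioi (0 : ℝ), (rootN μ σ r - rootM μ σ r) * H s ^ k ≠ 0 :=
    fun k s hs => mul_ne_zero hnm (Real.rpow_pos_of_pos (hH.pos s hs) k).ne'
  exact ⟨((contDiffOn_const.mul h2).sub (contDiffOn_const.mul hF)).div (hpow _) (hne _),
    ((contDiffOn_const.mul hF).sub (contDiffOn_const.mul h2)).div (hpow _) (hne _)⟩

lemma contDiffOn_upper (hσ : σ ≠ 0) (hr : 0 < r) (hm : rootM μ σ r + 1 < 0)
    (hmn : 0 ≤ rootM μ σ r + rootN μ σ r + 1) (hH : IsFreeBoundary μ σ r Hinf H) :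
    ContDiffOn ℝ 2 (Function.uncurry (upper μ σ r H)) quadrant := by
  obtain ⟨hA, hB⟩ := hH.contDiffOn_coef hσ hr hm hmn
  have hsnd : MapsTo (Prod.snd : ℝ × ℝ → ℝ) quadrant (Ioi 0) := fun p hp => hp.2
  have hpow : ∀ k : ℝ, ContDiffOn ℝ 2 (fun p : ℝ × ℝ => p.1 ^ k) quadrant := fun k =>
    contDiff_fst.contDiffOn.rpow_const_of_ne fun p hp => hp.1.ne'
  exact ((hA.comp contDiff_snd.contDiffOn hsnd).mul (hpow _)).add
    ((hB.comp contDiff_snd.contDiffOn hsnd).mul (hpow _))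

lemma continuousOn_boundary (hH : IsFreeBoundary μ σ r Hinf H) :
    ContinuousOn (fun p : ℝ × ℝ => p.1 - H p.2) quadrant := by
  have h : ContinuousOn H (Ioi 0) := fun s hs => (hH.continuousAt hs).continuousWithinAt
  exact continuousOn_fst.sub (h.comp continuousOn_snd fun p hp => hp.2)

/-- The two pieces of the candidate have the same differential along the free boundary. -/
lemma fderiv_lower_eq_fderiv_upper (hσ : σ ≠ 0) (hr : 0 < r) (hm : rootM μ σ r + 1 < 0)
    (hmn : 0 ≤ rootM μ σ r + rootN μ σ r + 1) (hH : IsFreeBoundary μ σ r Hinf H)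
    {s : ℝ} (hs : 0 < s) :
    fderiv ℝ (Function.uncurry lower) (H s, s) =
      fderiv ℝ (Function.uncurry (upper μ σ r H)) (H s, s) := by
  have hp := hH.pos s hs
  have hmem : quadrant ∈ 𝓝 (H s, s) := isOpen_quadrant.mem_nhds ⟨hp, hs⟩
  have hl := ((contDiffOn_lower (k := 2)).contDiffAt hmem).differentiableAt (by norm_num)
    |>.hasFDerivAt
  have hu := ((hH.contDiffOn_upper hσ hr hm hmn).contDiffAt hmem).differentiableAt (by norm_num)
    |>.hasFDerivAt
  have hcx : HasDerivAt (fun y : ℝ => (y, s)) (1, 0) (H s) :=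
    (hasDerivAt_id _).prodMk (hasDerivAt_const _ _)
  have hcs : HasDerivAt (fun u : ℝ => (H s, u)) (0, 1) s :=
    (hasDerivAt_const _ _).prodMk (hasDerivAt_id _)
  have hlx : HasDerivAt (fun y => lower y s)
      (fderiv ℝ (Function.uncurry lower) (H s, s) (1, 0)) (H s) :=
    HasFDerivAt.comp_hasDerivAt (f := fun y : ℝ => (y, s)) (H s) hl hcx
  have hux : HasDerivAt (fun y => upper μ σ r H y s)
      (fderiv ℝ (Function.uncurry (upper μ σ r H)) (H s, s) (1, 0)) (H s) :=
    HasFDerivAt.comp_hasDerivAt (f := fun y : ℝ => (y, s)) (H s) hu hcx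
  have hls : HasDerivAt (fun u => lower (H s) u)
      (fderiv ℝ (Function.uncurry lower) (H s, s) (0, 1)) s :=
    HasFDerivAt.comp_hasDerivAt (f := fun u : ℝ => (H s, u)) s hl hcs
  have hus : HasDerivAt (fun u => upper μ σ r H (H s) u)
      (fderiv ℝ (Function.uncurry (upper μ σ r H)) (H s, s) (0, 1)) s :=
    HasFDerivAt.comp_hasDerivAt (f := fun u : ℝ => (H s, u)) s hu hcs
  have hx : fderiv ℝ (Function.uncurry lower) (H s, s) (1, 0) =
      fderiv ℝ (Function.uncurry (upper μ σ r H)) (H s, s) (1, 0) := by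
    rw [hlx.unique (hasDerivAt_lower hp),
      hux.unique (hasDerivAt_upper hp), hH.upperX_eq hσ hr hm hs]
  have hy : fderiv ℝ (Function.uncurry lower) (H s, s) (0, 1) =
      fderiv ℝ (Function.uncurry (upper μ σ r H)) (H s, s) (0, 1) := by
    have h1 : HasDerivAt (fun u => lower (H s) u) ((H s)⁻¹ * Real.exp (-s)) s :=
      ((hasDerivAt_F s).const_mul _).sub_const 1
    rw [hls.unique h1,
      hus.unique (hH.hasDerivAt_upper_snd hσ hr hm hmn hp hs)]
    have h3 : 1 - (H s / s) ^ (rootN μ σ r - rootM μ σ r) ≠ 0 :=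
      (sub_pos.2 (hH.ratio_mem hσ hr hm hmn hs).2).ne'
    rw [div_self hp.ne', Real.one_rpow, Real.one_rpow, mul_one]
    field_simp
  ext
  · simpa using hx
  · simpa using hy

lemma cand_eq_ite (H : ℝ → ℝ) (p : ℝ × ℝ) :
    Function.uncurry (cand μ σ r H) p = if p.1 - H p.2 ≤ 0 then Function.uncurry lower p
      else Function.uncurry (upper μ σ r H) p := by
  by_cases h : p.1 ≤ H p.2
  · rw [if_pos (sub_nonpos.2 h)]; exact if_pos h
  · rw [if_neg (fun h' => h (sub_nonpos.1 h'))]; exact if_neg h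

lemma contDiffOn_one_cand (hσ : σ ≠ 0) (hr : 0 < r) (hm : rootM μ σ r + 1 < 0)
    (hmn : 0 ≤ rootM μ σ r + rootN μ σ r + 1) (hH : IsFreeBoundary μ σ r Hinf H) :
    ContDiffOn ℝ 1 (Function.uncurry (cand μ σ r H)) stateSpace := by
  classical
  have h := contDiffOn_one_ite isOpen_quadrant hH.continuousOn_boundary
    (contDiffOn_lower (k := 1)) ((hH.contDiffOn_upper hσ hr hm hmn).of_le (by norm_num)) (by
      rintro ⟨x, s⟩ ⟨hx, hs⟩ h0
      obtain rfl : x = H s := sub_eq_zero.1 h0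
      exact ⟨(hH.upper_eq_lower hσ hr hm hs).symm,
        hH.fderiv_lower_eq_fderiv_upper hσ hr hm hmn hs⟩)
  refine (h.mono stateSpace_subset_quadrant).congr fun p _ => ?_
  rw [cand_eq_ite]

lemma contDiffOn_two_cand (hσ : σ ≠ 0) (hr : 0 < r) (hm : rootM μ σ r + 1 < 0)
    (hmn : 0 ≤ rootM μ σ r + rootN μ σ r + 1) (hH : IsFreeBoundary μ σ r Hinf H) :
    ContDiffOn ℝ 2 (Function.uncurry (cand μ σ r H)) {p | p ∈ stateSpace ∧ p.1 ≠ H p.2} := by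
  rintro p ⟨hp, hne⟩
  have hmem : quadrant ∈ 𝓝 p := isOpen_quadrant.mem_nhds (stateSpace_subset_quadrant hp)
  have hc := hH.continuousOn_boundary.continuousAt hmem
  refine ContDiffAt.contDiffWithinAt ?_
  rcases lt_or_gt_of_ne hne with h | h
  · refine (contDiffOn_lower.contDiffAt hmem).congr_of_eventuallyEq ?_
    filter_upwards [hc.eventually_lt_const (sub_neg.2 h)] with q hq
    rw [cand_eq_ite, if_pos hq.le]
  · refine ((hH.contDiffOn_upper hσ hr hm hmn).contDiffAt hmem).congr_of_eventuallyEq ?_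
    filter_upwards [hc.eventually_const_lt (sub_pos.2 h)] with q hq
    rw [cand_eq_ite, if_neg hq.not_ge]

end IsFreeBoundary

/-! ### The variational inequality and the Neumann condition -/

namespace IsFreeBoundary

variable {μ σ r Hinf : ℝ} {H : ℝ → ℝ} {x s : ℝ}

open Classical in
lemma hasDerivAt_cand (hσ : σ ≠ 0) (hr : 0 < r) (hm : rootM μ σ r + 1 < 0)
    (hH : IsFreeBoundary μ σ r Hinf H) (hx : 0 < x) (hs : 0 < s) :
    HasDerivAt (fun y => cand μ σ r H y s)
      (if x - H s ≤ 0 then -F s / x ^ 2 else upperX μ σ r H x s) x := by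
  have h := hasDerivAt_ite (c := fun y => y - H s) (by fun_prop) (hasDerivAt_lower (s := s) hx)
    (hasDerivAt_upper (μ := μ) (σ := σ) (r := r) (H := H) (s := s) hx) (by
      intro h0
      obtain rfl : x = H s := sub_eq_zero.1 h0
      exact ⟨(hH.upper_eq_lower hσ hr hm hs).symm, (hH.upperX_eq hσ hr hm hs).symm⟩)
  refine h.congr_of_eventuallyEq (Eventually.of_forall fun y => ?_)
  have := cand_eq_ite (μ := μ) (σ := σ) (r := r) H (y, s)
  simpa [Function.uncurry] using this

lemma wx_cand_of_le (hσ : σ ≠ 0) (hr : 0 < r) (hm : rootM μ σ r + 1 < 0)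
    (hH : IsFreeBoundary μ σ r Hinf H) (hx : 0 < x) (hxs : x ≤ s) (h : x ≤ H s) :
    wx (cand μ σ r H) x s = -F s / x ^ 2 := by
  have hd := hH.hasDerivAt_cand hσ hr hm hx (hx.trans_le hxs)
  rw [if_pos (sub_nonpos.2 h)] at hd
  exact hd.hasDerivWithinAt.derivWithin (uniqueDiffOn_Ioc 0 s x ⟨hx, hxs⟩)

lemma wx_cand_of_ge (hσ : σ ≠ 0) (hr : 0 < r) (hm : rootM μ σ r + 1 < 0)
    (hH : IsFreeBoundary μ σ r Hinf H) (hx : 0 < x) (hxs : x ≤ s) (h : H s ≤ x) :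
    wx (cand μ σ r H) x s = upperX μ σ r H x s := by
  have hs := hx.trans_le hxs
  rcases h.eq_or_lt with rfl | h
  · rw [hH.wx_cand_of_le hσ hr hm hx hxs le_rfl, hH.upperX_eq hσ hr hm hs]
  have hd := hH.hasDerivAt_cand hσ hr hm hx hs
  rw [if_neg (not_le.2 (sub_pos.2 h))] at hd
  exact hd.hasDerivWithinAt.derivWithin (uniqueDiffOn_Ioc 0 s x ⟨hx, hxs⟩)

lemma hasDerivWithinAt_wx_left_of_le (hσ : σ ≠ 0) (hr : 0 < r) (hm : rootM μ σ r + 1 < 0)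
    (hH : IsFreeBoundary μ σ r Hinf H) (hx : 0 < x) (hxs : x ≤ s) (h : x ≤ H s) :
    HasDerivWithinAt (fun y => wx (cand μ σ r H) y s) (2 * F s / x ^ 3) (Ioc 0 x) x :=
  (hasDerivAt_lowerX hx).hasDerivWithinAt.congr
    (fun _ hy => hH.wx_cand_of_le hσ hr hm hy.1 (hy.2.trans hxs) (hy.2.trans h))
    (hH.wx_cand_of_le hσ hr hm hx hxs h)

lemma hasDerivWithinAt_wx_left_of_gt (hσ : σ ≠ 0) (hr : 0 < r) (hm : rootM μ σ r + 1 < 0)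
    (hH : IsFreeBoundary μ σ r Hinf H) (hx : 0 < x) (hxs : x ≤ s) (h : H s < x) :
    HasDerivWithinAt (fun y => wx (cand μ σ r H) y s) (upperXX μ σ r H x s) (Ioc 0 x) x := by
  refine (hasDerivAt_upperX hx).hasDerivWithinAt.congr_of_eventuallyEq ?_
    (hH.wx_cand_of_ge hσ hr hm hx hxs h.le)
  filter_upwards [self_mem_nhdsWithin, mem_nhdsWithin_of_mem_nhds (lt_mem_nhds h)] with y hy hHy
  exact hH.wx_cand_of_ge hσ hr hm hy.1 (hy.2.trans hxs) (le_of_lt hHy)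

lemma hasDerivWithinAt_wx_right_of_lt (hσ : σ ≠ 0) (hr : 0 < r) (hm : rootM μ σ r + 1 < 0)
    (hH : IsFreeBoundary μ σ r Hinf H) (hx : 0 < x) (hxs : x ≤ s) (h : x < H s) :
    HasDerivWithinAt (fun y => wx (cand μ σ r H) y s) (2 * F s / x ^ 3) (Ico x s) x := by
  refine (hasDerivAt_lowerX hx).hasDerivWithinAt.congr_of_eventuallyEq ?_
    (hH.wx_cand_of_le hσ hr hm hx hxs h.le)
  filter_upwards [self_mem_nhdsWithin, mem_nhdsWithin_of_mem_nhds (gt_mem_nhds h)] with y hy hHy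
  exact hH.wx_cand_of_le hσ hr hm (hx.trans_le hy.1) hy.2.le (le_of_lt hHy)

lemma hasDerivWithinAt_wx_right_of_ge (hσ : σ ≠ 0) (hr : 0 < r) (hm : rootM μ σ r + 1 < 0)
    (hH : IsFreeBoundary μ σ r Hinf H) (hx : 0 < x) (hxs : x ≤ s) (h : H s ≤ x) :
    HasDerivWithinAt (fun y => wx (cand μ σ r H) y s) (upperXX μ σ r H x s) (Ico x s) x :=
  (hasDerivAt_upperX hx).hasDerivWithinAt.congr
    (fun _ hy => hH.wx_cand_of_ge hσ hr hm (hx.trans_le hy.1) hy.2.le (h.trans hy.1))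
    (hH.wx_cand_of_ge hσ hr hm hx hxs h)

/-- In the continuation region the candidate solves the linear equation. -/
lemma genOp_upper (hσ : σ ≠ 0) (hr : 0 < r) (hx : 0 < x) :
    genOp μ σ r x (upper μ σ r H x s) (upperX μ σ r H x s) (upperXX μ σ r H x s) = 0 := by
  have hn := rootN_char (μ := μ) hσ hr
  have hm := rootM_char (μ := μ) hσ hr
  have e1 : ∀ k : ℝ, x ^ k = x ^ (k - 1 - 1) * x ^ 2 := fun k => by
    rw [← Real.rpow_natCast x 2, ← Real.rpow_add hx]
    congr 1; push_cast; ring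
  have e2 : ∀ k : ℝ, x ^ (k - 1) = x ^ (k - 1 - 1) * x := fun k => by
    nth_rewrite 3 [← Real.rpow_one x]
    rw [← Real.rpow_add hx]
    congr 1; ring
  rw [genOp, upper, upperX, upperXX, e1 (rootN μ σ r), e1 (rootM μ σ r), e2 (rootN μ σ r),
    e2 (rootM μ σ r)]
  linear_combination (coefA μ σ r H s * x ^ (rootN μ σ r - 1 - 1) * x ^ 2) * hn +
    (coefB μ σ r H s * x ^ (rootM μ σ r - 1 - 1) * x ^ 2) * hm

/-- The stopping region lies in `{x < G}`, where stopping is locally favourable. -/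
lemma genOp_lower_nonpos (hσ : σ ≠ 0) (hr : 0 < r)
    (hH : IsFreeBoundary μ σ r Hinf H) (hx : 0 < x) (hs : 0 < s) (h : x ≤ H s) :
    genOp μ σ r x (lower x s) (-F s / x ^ 2) (2 * F s / x ^ 3) ≤ 0 := by
  have hG := h.trans (hH.lt_G s hs).le
  rw [G, GInf_eq hσ hr, div_mul_eq_mul_div, le_div_iff₀ hr] at hG
  have e : genOp μ σ r x (lower x s) (-F s / x ^ 2) (2 * F s / x ^ 3) =
      (r * x - (r + μ - σ ^ 2) * F s) / x := by
    rw [genOp, lower]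
    field_simp
    ring
  rw [e]
  exact div_nonpos_of_nonpos_of_nonneg (by linarith) hx.le

/-- The function `x w + x` is convex for `x ≥ H` and tangent to the constant `F` at `x = H`, so
that the candidate lies above the payoff in the continuation region. -/
lemma lower_le_upper (hσ : σ ≠ 0) (hr : 0 < r) (hm : rootM μ σ r + 1 < 0)
    (hmn : 0 ≤ rootM μ σ r + rootN μ σ r + 1) (hH : IsFreeBoundary μ σ r Hinf H)
    (hs : 0 < s) (hA : 0 ≤ coefA μ σ r H s) (h : H s ≤ x) :
    lower x s ≤ upper μ σ r H x s := by
  have hn := rootN_pos hσ hr hm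
  have hp := hH.pos s hs
  have hx : 0 < x := hp.trans_le h
  have hB := (hH.coefB_pos hσ hr hm hmn hs).le
  set u := x / H s with hu
  have hu1 : 1 ≤ u := (one_le_div hp).2 h
  have hxu : x = H s * u := by rw [hu]; field_simp
  have b1 : 1 + (rootN μ σ r + 1) * (u - 1) ≤ u ^ (rootN μ σ r + 1) := by
    have := one_add_mul_self_le_rpow_one_add (s := u - 1) (by linarith) (p := rootN μ σ r + 1)
      (by linarith)
    simpa using this
  have b2 : 1 + (rootM μ σ r + 1) * (u - 1) ≤ u ^ (rootM μ σ r + 1) := by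
    rw [Real.rpow_def_of_pos (by linarith)]
    have h1 := Real.add_one_le_exp (Real.log u * (rootM μ σ r + 1))
    have h2 := Real.log_le_sub_one_of_pos (show 0 < u by linarith)
    nlinarith
  have hA' := hH.coefA_mul hs
  have hB' := hH.coefB_mul hs
  have hmul : upper μ σ r H x s * x =
      coefA μ σ r H s * H s ^ (rootN μ σ r + 1) * u ^ (rootN μ σ r + 1) +
      coefB μ σ r H s * H s ^ (rootM μ σ r + 1) * u ^ (rootM μ σ r + 1) := by
    rw [mul_assoc, mul_assoc, ← Real.mul_rpow hp.le (by linarith),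
      ← Real.mul_rpow hp.le (by linarith), ← hxu, Real.rpow_add hx, Real.rpow_add hx, Real.rpow_one,
      upper]
    ring
  have c1 := mul_le_mul_of_nonneg_left b1
    (mul_nonneg hA (Real.rpow_pos_of_pos hp (rootN μ σ r + 1)).le)
  have c2 := mul_le_mul_of_nonneg_left b2
    (mul_nonneg hB (Real.rpow_pos_of_pos hp (rootM μ σ r + 1)).le)
  have hlin : coefA μ σ r H s * H s ^ (rootN μ σ r + 1) * (1 + (rootN μ σ r + 1) * (u - 1)) +
      coefB μ σ r H s * H s ^ (rootM μ σ r + 1) * (1 + (rootM μ σ r + 1) * (u - 1)) =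
      F s - x := by
    rw [hA', hB', hxu]
    have : rootN μ σ r - rootM μ σ r ≠ 0 := by linarith
    field_simp
    ring
  have hfin : F s - x ≤ upper μ σ r H x s * x := by linarith
  have e : lower x s = (F s - x) / x := by rw [lower]; field_simp
  rw [e]
  exact (div_le_iff₀ hx).2 hfin

lemma upper_pos (hσ : σ ≠ 0) (hr : 0 < r) (hm : rootM μ σ r + 1 < 0)
    (hmn : 0 ≤ rootM μ σ r + rootN μ σ r + 1) (hH : IsFreeBoundary μ σ r Hinf H)
    (hx : 0 < x) (hs : 0 < s) (hA : 0 ≤ coefA μ σ r H s) : 0 < upper μ σ r H x s :=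
  add_pos_of_nonneg_of_pos (mul_nonneg hA (Real.rpow_pos_of_pos hx _).le)
    (mul_pos (hH.coefB_pos hσ hr hm hmn hs) (Real.rpow_pos_of_pos hx _))

lemma lower_pos (hσ : σ ≠ 0) (hr : 0 < r) (hm : rootM μ σ r + 1 < 0)
    (hmn : 0 ≤ rootM μ σ r + rootN μ σ r + 1) (hH : IsFreeBoundary μ σ r Hinf H)
    (hx : 0 < x) (hs : 0 < s) (h : x ≤ H s) : 0 < lower x s := by
  have h1 : x < F s := h.trans_lt (hH.lt_F hσ hr hm hmn hs)
  rw [lower, sub_pos, inv_mul_eq_div]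
  exact (one_lt_div hx).2 h1

lemma cand_pos (hσ : σ ≠ 0) (hr : 0 < r) (hm : rootM μ σ r + 1 < 0)
    (hmn : 0 ≤ rootM μ σ r + rootN μ σ r + 1) (hH : IsFreeBoundary μ σ r Hinf H)
    (hx : 0 < x) (hs : 0 < s) (hA : 0 ≤ coefA μ σ r H s) : 0 < cand μ σ r H x s := by
  rcases le_or_gt x (H s) with h | h
  · rw [cand_of_le h]; exact hH.lower_pos hσ hr hm hmn hx hs h
  · rw [cand_of_lt h]; exact hH.upper_pos hσ hr hm hmn hx hs hA

theorem solvesVI (hσ : σ ≠ 0) (hr : 0 < r) (hm : rootM μ σ r + 1 < 0)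
    (hmn : 0 ≤ rootM μ σ r + rootN μ σ r + 1) (hH : IsFreeBoundary μ σ r Hinf H)
    (hA : ∀ s, 0 < s → 0 ≤ coefA μ σ r H s) : SolvesVI μ σ r (cand μ σ r H) := by
  intro x s hx hxs
  have hs : 0 < s := hx.trans_le hxs
  have hlow : x ≤ H s → max (genOp μ σ r x (cand μ σ r H x s) (wx (cand μ σ r H) x s)
      (2 * F s / x ^ 3)) (reward x s - cand μ σ r H x s) = 0 := by
    intro h
    have h1 : reward x s - cand μ σ r H x s = 0 := by
      have h2 : reward x s = lower x s := max_eq_left (hH.lower_pos hσ hr hm hmn hx hs h).le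
      rw [cand_of_le h, h2, sub_self]
    rw [h1, hH.wx_cand_of_le hσ hr hm hx hxs h, cand_of_le h]
    exact max_eq_right (hH.genOp_lower_nonpos hσ hr hx hs h)
  have hupp : H s ≤ x → max (genOp μ σ r x (cand μ σ r H x s) (wx (cand μ σ r H) x s)
      (upperXX μ σ r H x s)) (reward x s - cand μ σ r H x s) = 0 := by
    intro h
    have e : cand μ σ r H x s = upper μ σ r H x s := by
      rcases h.eq_or_lt with rfl | h
      · rw [cand_of_le le_rfl, hH.upper_eq_lower hσ hr hm hs]
      · exact cand_of_lt h
    have h1 : reward x s ≤ upper μ σ r H x s :=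
      max_le (hH.lower_le_upper hσ hr hm hmn hs (hA s hs) h)
        (hH.upper_pos hσ hr hm hmn hx hs (hA s hs)).le
    rw [hH.wx_cand_of_ge hσ hr hm hx hxs h, e, genOp_upper hσ hr hx]
    exact max_eq_left (sub_nonpos.2 h1)
  refine ⟨(hH.hasDerivAt_cand hσ hr hm hx hs).differentiableAt.differentiableWithinAt, ?_⟩
  have hu : UniqueDiffWithinAt ℝ (Ioc 0 x) x := uniqueDiffOn_Ioc 0 x x ⟨hx, le_rfl⟩
  have hleft : DifferentiableWithinAt ℝ (fun y => wx (cand μ σ r H) y s) (Ioc 0 x) x ∧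
      max (genOp μ σ r x (cand μ σ r H x s) (wx (cand μ σ r H) x s)
        (wxxLeft (cand μ σ r H) x s)) (reward x s - cand μ σ r H x s) = 0 := by
    rcases le_or_gt x (H s) with h | h
    · have hd := hH.hasDerivWithinAt_wx_left_of_le hσ hr hm hx hxs h
      rw [wxxLeft, hd.derivWithin hu]
      exact ⟨hd.differentiableWithinAt, hlow h⟩
    · have hd := hH.hasDerivWithinAt_wx_left_of_gt hσ hr hm hx hxs h
      rw [wxxLeft, hd.derivWithin hu]
      exact ⟨hd.differentiableWithinAt, hupp h.le⟩
  refine ⟨hleft.1, hleft.2, fun hlt => ?_⟩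
  have hu' : UniqueDiffWithinAt ℝ (Ico x s) x := uniqueDiffOn_Ico x s x ⟨le_rfl, hlt⟩
  rcases lt_or_ge x (H s) with h | h
  · have hd := hH.hasDerivWithinAt_wx_right_of_lt hσ hr hm hx hxs h
    rw [wxxRight, hd.derivWithin hu']
    exact ⟨hd.differentiableWithinAt, hlow h.le⟩
  · have hd := hH.hasDerivWithinAt_wx_right_of_ge hσ hr hm hx hxs h
    rw [wxxRight, hd.derivWithin hu']
    exact ⟨hd.differentiableWithinAt, hupp h⟩

/-- The free-boundary equation says exactly that the two contributions to `w_s` cancel on the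
diagonal. -/
theorem solvesNeumann (hσ : σ ≠ 0) (hr : 0 < r) (hm : rootM μ σ r + 1 < 0)
    (hmn : 0 ≤ rootM μ σ r + rootN μ σ r + 1) (hH : IsFreeBoundary μ σ r Hinf H) :
    SolvesNeumann (cand μ σ r H) := by
  intro s hs
  have hp := hH.pos s hs
  have hlt := hH.lt_self hσ hr hm hmn hs
  have hd : HasDerivAt (fun u => upper μ σ r H s u) 0 s := by
    refine (hH.hasDerivAt_upper_snd hσ hr hm hmn hs hs).congr_deriv ?_
    have e : (s / H s) ^ rootM μ σ r -
        (H s / s) ^ (rootN μ σ r - rootM μ σ r) * (s / H s) ^ rootN μ σ r = 0 := by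
      have hq : 0 < s / H s := div_pos hs hp
      rw [← inv_div s (H s), Real.inv_rpow hq.le, ← Real.rpow_neg hq.le, ← Real.rpow_add hq]
      rw [sub_eq_zero]
      congr 1; ring
    rw [e, mul_zero]
  refine (hd.congr_of_eventuallyEq ?_).hasDerivWithinAt
  filter_upwards [(hH.continuousAt hs).eventually_lt_const hlt] with u hu
  exact cand_of_lt hu

/-! ### Growth of the candidate -/

/-- If the coefficient `A` has a negative limit, the candidate tends to `-∞` on the diagonal. -/
lemma exists_cand_neg (hσ : σ ≠ 0) (hr : 0 < r) (hm : rootM μ σ r + 1 < 0)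
    (hmn : 0 ≤ rootM μ σ r + rootN μ σ r + 1) (hH₀ : 0 < Hinf)
    (hH : IsFreeBoundary μ σ r Hinf H) (h : HCrit μ σ r < Hinf) :
    ∃ s, 0 < s ∧ cand μ σ r H s s < 0 := by
  have hn := rootN_pos hσ hr hm
  have hA := hH.tendsto_coefA hσ hr hm hH₀
  have hAn := hA.neg_mul_atTop (limA_neg hσ hr hm hH₀ h) (tendsto_rpow_atTop hn)
  have hB : ∀ s, 1 ≤ s → coefB μ σ r H s * s ^ rootM μ σ r ≤
      (rootN μ σ r + 1) / (rootN μ σ r - rootM μ σ r) := by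
    intro s hs
    have hs0 : 0 < s := by linarith
    have hp := hH.pos s hs0
    have hlt := hH.lt_self hσ hr hm hmn hs0
    have h1 : s ^ rootM μ σ r ≤ H s ^ (rootM μ σ r + 1) := by
      calc s ^ rootM μ σ r ≤ s ^ (rootM μ σ r + 1) :=
            Real.rpow_le_rpow_of_exponent_le hs (by linarith)
        _ ≤ H s ^ (rootM μ σ r + 1) := Real.rpow_le_rpow_of_nonpos hp hlt.le (by linarith)
    refine (mul_le_mul_of_nonneg_left h1 (hH.coefB_pos hσ hr hm hmn hs0).le).trans ?_
    rw [hH.coefB_mul hs0]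
    have h2 := F_lt_one s
    gcongr
    · linarith
    · nlinarith
  have hlim : Tendsto (fun s => coefA μ σ r H s * s ^ rootN μ σ r +
      (rootN μ σ r + 1) / (rootN μ σ r - rootM μ σ r)) atTop atBot :=
    tendsto_atBot_add_const_right _ _ hAn
  obtain ⟨s, hs, hs1⟩ := ((hlim.eventually_lt_atBot 0).and (eventually_ge_atTop 1)).exists
  have hs0 : 0 < s := by linarith
  refine ⟨s, hs0, ?_⟩
  rw [cand_of_lt (hH.lt_self hσ hr hm hmn hs0), upper]
  linarith [hB s hs1]

/-- The lower of the two bounds that determine the limit of the discounted expectations. Below the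
free boundary, where `x ≤ H_∞`, the term `x^n` is absorbed by a multiple of `x⁻¹`. -/
lemma le_cand (hσ : σ ≠ 0) (hr : 0 < r) (hm : rootM μ σ r + 1 < 0)
    (hmn : 0 ≤ rootM μ σ r + rootN μ σ r + 1) (hH₀ : 0 < Hinf)
    (hH : IsFreeBoundary μ σ r Hinf H) (h : Hinf ≤ HCrit μ σ r) (hx : 0 < x) (hs : 0 < s) :
    limA μ σ r Hinf * x ^ rootN μ σ r -
      limA μ σ r Hinf * Hinf ^ (rootN μ σ r + 1) * x⁻¹ ≤ cand μ σ r H x s := by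
  have hn := rootN_pos hσ hr hm
  have ha := limA_nonneg hσ hr hm hH₀ h
  have hAa := (hH.limA_lt_coefA hσ hr hm hmn hH₀ hs).le
  have hC : 0 ≤ limA μ σ r Hinf * Hinf ^ (rootN μ σ r + 1) * x⁻¹ :=
    mul_nonneg (mul_nonneg ha (Real.rpow_pos_of_pos hH₀ _).le) (inv_pos.2 hx).le
  rcases le_or_gt x (H s) with hxH | hxH
  · refine le_trans ?_ (hH.cand_pos hσ hr hm hmn hx hs (ha.trans hAa)).le
    have h1 : x ^ rootN μ σ r ≤ Hinf ^ (rootN μ σ r + 1) * x⁻¹ := by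
      rw [← div_eq_mul_inv, le_div_iff₀ hx]
      have : x ^ rootN μ σ r * x = x ^ (rootN μ σ r + 1) := by
        rw [Real.rpow_add hx, Real.rpow_one]
      rw [this]
      exact Real.rpow_le_rpow hx.le (hxH.trans (hH.lt_Hinf hs).le) (by linarith)
    have h2 := mul_le_mul_of_nonneg_left h1 ha
    linarith
  · rw [cand_of_lt hxH, upper]
    have h1 := mul_le_mul_of_nonneg_right hAa (Real.rpow_pos_of_pos hx (rootN μ σ r)).le
    have h2 := mul_pos (hH.coefB_pos hσ hr hm hmn hs) (Real.rpow_pos_of_pos hx (rootM μ σ r))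
    linarith

/-- The upper of the two bounds that determine the limit of the discounted expectations. The term
with `x^m` is at most a multiple of `x⁻¹` above the free boundary because `m < -1`, and `A` is close
to its limit as soon as `s` is large. -/
lemma exists_cand_le (hσ : σ ≠ 0) (hr : 0 < r) (hm : rootM μ σ r + 1 < 0)
    (hmn : 0 ≤ rootM μ σ r + rootN μ σ r + 1) (hH₀ : 0 < Hinf)
    (hH : IsFreeBoundary μ σ r Hinf H) (h : Hinf ≤ HCrit μ σ r) {s₀ ε : ℝ} (hs₀ : 0 < s₀)
    (hε : 0 < ε) :
    ∃ C, ∀ x s, 0 < x → x ≤ s → s₀ ≤ s →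
      cand μ σ r H x s ≤ (limA μ σ r Hinf + ε) * x ^ rootN μ σ r + C * x⁻¹ := by
  have hn := rootN_pos hσ hr hm
  have ha := limA_nonneg hσ hr hm hH₀ h
  have hApos : ∀ s, 0 < s → 0 ≤ coefA μ σ r H s := fun s hs =>
    ha.trans (hH.limA_lt_coefA hσ hr hm hmn hH₀ hs).le
  obtain ⟨K₀, hK₀⟩ := eventually_atTop.1 ((hH.tendsto_coefA hσ hr hm hH₀).eventually_lt_const
    (show limA μ σ r Hinf < limA μ σ r Hinf + ε by linarith))
  obtain ⟨K, hK, hK0⟩ : ∃ K, (∀ s, K ≤ s → coefA μ σ r H s < limA μ σ r Hinf + ε) ∧ 0 < K :=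
    ⟨max K₀ 1, fun s hs => hK₀ s ((le_max_left _ _).trans hs), by positivity⟩
  have hcB : 0 ≤ (rootN μ σ r + 1) / (rootN μ σ r - rootM μ σ r) :=
    div_nonneg (by linarith) (by linarith)
  have hcA : 0 ≤ coefA μ σ r H s₀ * K ^ (rootN μ σ r + 1) :=
    mul_nonneg (hApos s₀ hs₀) (Real.rpow_pos_of_pos hK0 _).le
  refine ⟨1 + (rootN μ σ r + 1) / (rootN μ σ r - rootM μ σ r) +
    coefA μ σ r H s₀ * K ^ (rootN μ σ r + 1), fun x s hx hxs hs₀s => ?_⟩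
  have hs : 0 < s := hs₀.trans_le hs₀s
  have hp := hH.pos s hs
  have hxi : 0 < x⁻¹ := inv_pos.2 hx
  have hxn : 0 < x ^ rootN μ σ r := Real.rpow_pos_of_pos hx _
  have t1 : 0 ≤ (limA μ σ r Hinf + ε) * x ^ rootN μ σ r := by positivity
  have t2 := mul_nonneg hcB hxi.le
  have t3 := mul_nonneg hcA hxi.le
  rcases le_or_gt x (H s) with hxH | hxH
  · rw [cand_of_le hxH, lower]
    have h1 := mul_le_mul_of_nonneg_left (F_lt_one s).le hxi.le
    linarith
  · rw [cand_of_lt hxH, upper]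
    have eB : coefB μ σ r H s * x ^ rootM μ σ r ≤
        (rootN μ σ r + 1) / (rootN μ σ r - rootM μ σ r) * x⁻¹ := by
      rw [← div_eq_mul_inv, le_div_iff₀ hx, mul_assoc]
      have e : x ^ rootM μ σ r * x = x ^ (rootM μ σ r + 1) := by
        rw [Real.rpow_add hx, Real.rpow_one]
      rw [e]
      refine (mul_le_mul_of_nonneg_left (Real.rpow_le_rpow_of_nonpos hp hxH.le (by linarith))
        (hH.coefB_pos hσ hr hm hmn hs).le).trans ?_
      rw [hH.coefB_mul hs]
      have h2 := F_lt_one s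
      gcongr
      · linarith
      · nlinarith
    have eA : coefA μ σ r H s * x ^ rootN μ σ r ≤
        (limA μ σ r Hinf + ε) * x ^ rootN μ σ r +
          coefA μ σ r H s₀ * K ^ (rootN μ σ r + 1) * x⁻¹ := by
      rcases le_or_gt K s with hKs | hKs
      · have := mul_le_mul_of_nonneg_right (hK s hKs).le hxn.le
        linarith
      · -- here `x ≤ s < K`, so that `x ^ n ≤ K ^ (n + 1) / x`
        have h1 : coefA μ σ r H s ≤ coefA μ σ r H s₀ :=
          (hH.strictAntiOn_coefA hσ hr hm hmn).antitoneOn hs₀ hs hs₀s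
        have h2 : x ^ rootN μ σ r ≤ K ^ (rootN μ σ r + 1) * x⁻¹ := by
          rw [← div_eq_mul_inv, le_div_iff₀ hx]
          have e : x ^ rootN μ σ r * x = x ^ (rootN μ σ r + 1) := by
            rw [Real.rpow_add hx, Real.rpow_one]
          rw [e]
          exact Real.rpow_le_rpow hx.le (hxs.trans hKs.le) (by linarith)
        have h3 := mul_le_mul h1 h2 hxn.le (hApos s₀ hs₀)
        linarith
    linarith

end IsFreeBoundary

/-! ### Transversality -/

section Transversality

variable {Ω : Type u} {mΩ : MeasurableSpace Ω} {P : Measure Ω} {ℱ : Filtration ℝ≥0 mΩ}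
  {W : ℝ≥0 → Ω → ℝ} {μ σ r Hinf : ℝ} {H : ℝ → ℝ} {x s : ℝ} [IsProbabilityMeasure P]

/-- Along every sequence of bounded stopping times tending to infinity, the discounted expectation
of the candidate tends to `A_∞ x^n`. -/
theorem IsFreeBoundary.tendsto_integral_discounted_cand (hσ : σ ≠ 0) (hr : 0 < r)
    (hm : rootM μ σ r + 1 < 0) (hmn : 0 ≤ rootM μ σ r + rootN μ σ r + 1) (hH₀ : 0 < Hinf)
    (hH : IsFreeBoundary μ σ r Hinf H) (h : Hinf ≤ HCrit μ σ r) (hW : IsBrownianSetup P ℱ W)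
    (hx : 0 < x) (hxs : x ≤ s) {τ : ℕ → Ω → ℝ≥0} (hτ : IsBoundedStoppingSeq P ℱ τ) :
    (∀ l, Integrable (discounted μ σ r (cand μ σ r H) W x s (τ l)) P) ∧
      Tendsto (fun l => ∫ ω, discounted μ σ r (cand μ σ r H) W x s (τ l) ω ∂P) atTop
        (𝓝 (limA μ σ r Hinf * x ^ rootN μ σ r)) :=
  tendsto_integral_discounted hW (rootN_char hσ hr) (sq_lt_of_rootM hσ hr hm) hx
    (hH.contDiffOn_one_cand hσ hr hm hmn).continuousOn
    (fun _ _ hy hys _ => hH.le_cand hσ hr hm hmn hH₀ h hy (hy.trans_le hys))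
    (fun _ hε => hH.exists_cand_le hσ hr hm hmn hH₀ h (hx.trans_le hxs) hε) hτ

omit [IsProbabilityMeasure P] in
lemma isBoundedStoppingSeq_const {T : ℕ → ℝ≥0} (hT : Tendsto T atTop atTop) :
    IsBoundedStoppingSeq P ℱ fun l _ => T l where
  stopping l := isStoppingTime_const ℱ (T l)
  bounded l := ⟨T l, fun _ => le_rfl⟩
  tendsto_top := Eventually.of_forall fun _ => hT

omit [IsProbabilityMeasure P] in
lemma integral_discounted_const (w : ℝ → ℝ → ℝ) (T : ℝ≥0) :
    ∫ ω, discounted μ σ r w W x s (fun _ => T) ω ∂P =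
      Real.exp (-r * T) * ∫ ω, w (gbm μ σ W x T ω) (runMax μ σ W x s T ω) ∂P := by
  simp only [discounted, integral_const_mul]

variable (hσ : σ ≠ 0) (hr : 0 < r) (hm : rootM μ σ r + 1 < 0)
  (hmn : 0 ≤ rootM μ σ r + rootN μ σ r + 1) (hH₀ : 0 < Hinf)
  (hH : IsFreeBoundary μ σ r Hinf H) (h : Hinf ≤ HCrit μ σ r) (hW : IsBrownianSetup P ℱ W)
  (hx : 0 < x) (hxs : x ≤ s)

include hσ hr hm hmn hH₀ hH h hW hx hxs

lemma IsFreeBoundary.integrable_cand (T : ℝ≥0) :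
    Integrable (fun ω => cand μ σ r H (gbm μ σ W x T ω) (runMax μ σ W x s T ω)) P := by
  -- the constant time `T` is the first term of the sequence `T + l`
  have hT : Tendsto (fun l : ℕ => T + (l : ℝ≥0)) atTop atTop :=
    tendsto_atTop_mono (fun l => le_add_self) tendsto_natCast_atTop_atTop
  have hi := (hH.tendsto_integral_discounted_cand hσ hr hm hmn hH₀ h hW hx hxs
    (isBoundedStoppingSeq_const hT)).1 0
  refine (hi.const_mul (Real.exp (r * T))).congr (Eventually.of_forall fun ω => ?_)
  simp only [discounted, Nat.cast_zero, add_zero]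
  rw [← mul_assoc, ← Real.exp_add]
  simp

lemma IsFreeBoundary.tendsto_exp_mul_integral_cand :
    Tendsto (fun T : ℝ≥0 => Real.exp (-r * (T : ℝ)) *
      ∫ ω, cand μ σ r H (gbm μ σ W x T ω) (runMax μ σ W x s T ω) ∂P) atTop
        (𝓝 (limA μ σ r Hinf * x ^ rootN μ σ r)) := by
  refine tendsto_of_seq_tendsto fun T hT => ?_
  have hl := (hH.tendsto_integral_discounted_cand hσ hr hm hmn hH₀ h hW hx hxs
    (isBoundedStoppingSeq_const hT)).2
  exact hl.congr fun l => integral_discounted_const _ (T l)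

end Transversality

end

end RunningMax

theorem mainTheorem2 (μ σ r : ℝ) (hσ : σ ≠ 0) (hr : 0 < r)
    (hm : rootM μ σ r + 1 < 0) (hmn : 0 ≤ rootM μ σ r + rootN μ σ r + 1)
    (Hinf : ℝ) (hH₀ : 0 < Hinf) (hH₁ : Hinf ≤ GInf μ σ r) :
    ∃ Ainf : ℝ, (Hinf < HCrit μ σ r → 0 < Ainf) ∧
      ∀ H : ℝ → ℝ, IsFreeBoundary μ σ r Hinf H →
        -- (I) regularity
        (ContDiffOn ℝ 1 (Function.uncurry (cand μ σ r H)) stateSpace ∧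
          ContDiffOn ℝ 2 (Function.uncurry (cand μ σ r H))
            {p | p ∈ stateSpace ∧ p.1 ≠ H p.2}) ∧
        -- (II) failure of the variational inequality
        (HCrit μ σ r < Hinf →
          ¬ SolvesVI μ σ r (cand μ σ r H) ∧
          ∃ x s : ℝ, 0 < x ∧ x ≤ s ∧ cand μ σ r H x s < 0) ∧
        -- (III) positivity, variational inequality and Neumann condition
        (Hinf ≤ HCrit μ σ r →
          (∀ x s : ℝ, 0 < x → x ≤ s → 0 < cand μ σ r H x s) ∧
          SolvesVI μ σ r (cand μ σ r H) ∧
          SolvesNeumann (cand μ σ r H)) ∧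
        -- (IV) failure of transversality
        (Hinf < HCrit μ σ r →
          ∀ (Ω : Type u) (mΩ : MeasurableSpace Ω) (P : Measure Ω) (_ : IsProbabilityMeasure P)
            (ℱ : Filtration ℝ≥0 mΩ) (W : ℝ≥0 → Ω → ℝ), IsBrownianSetup P ℱ W →
          ∀ x s : ℝ, 0 < x → x ≤ s →
            (∀ T : ℝ≥0, Integrable
              (fun ω => cand μ σ r H (gbm μ σ W x T ω) (runMax μ σ W x s T ω)) P) ∧
            ¬ Transversality μ σ r (cand μ σ r H) P W x s ∧
            ∀ τ : ℕ → Ω → ℝ≥0, IsBoundedStoppingSeq P ℱ τ →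
              (∀ l, Integrable (discounted μ σ r (cand μ σ r H) W x s (τ l)) P) ∧
              ∃ L : ℝ,
                Tendsto (fun l => ∫ ω, discounted μ σ r (cand μ σ r H) W x s (τ l) ω ∂P)
                  atTop (𝓝 L) ∧
                Ainf * x ^ rootN μ σ r ≤ L ∧ 0 < Ainf * x ^ rootN μ σ r) ∧
        -- (V) transversality in the critical case
        (Hinf = HCrit μ σ r →
          ∀ (Ω : Type u) (mΩ : MeasurableSpace Ω) (P : Measure Ω) (_ : IsProbabilityMeasure P)
            (ℱ : Filtration ℝ≥0 mΩ) (W : ℝ≥0 → Ω → ℝ), IsBrownianSetup P ℱ W →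
          ∀ x s : ℝ, 0 < x → x ≤ s →
            (∀ T : ℝ≥0, Integrable
              (fun ω => cand μ σ r H (gbm μ σ W x T ω) (runMax μ σ W x s T ω)) P) ∧
            Transversality μ σ r (cand μ σ r H) P W x s ∧
            ∀ τ : ℕ → Ω → ℝ≥0, IsBoundedStoppingSeq P ℱ τ →
              (∀ l, Integrable (discounted μ σ r (cand μ σ r H) W x s (τ l)) P) ∧
              Tendsto (fun l => ∫ ω, discounted μ σ r (cand μ σ r H) W x s (τ l) ω ∂P)
                atTop (𝓝 0)) := by
  refine ⟨limA μ σ r Hinf, limA_pos hσ hr hm hH₀, fun H hH => ⟨⟨hH.contDiffOn_one_cand hσ hr hm hmn,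
    hH.contDiffOn_two_cand hσ hr hm hmn⟩, fun h => ?_, fun h => ?_, fun h => ?_, fun h => ?_⟩⟩
  · obtain ⟨s, hs, hneg⟩ := hH.exists_cand_neg hσ hr hm hmn hH₀ h
    refine ⟨fun hVI => ?_, s, s, hs, le_rfl, hneg⟩
    have h1 := (hVI s s hs le_rfl).2.2.1
    have h2 := h1 ▸ le_max_right (genOp μ σ r s (cand μ σ r H s s) (wx (cand μ σ r H) s s)
      (wxxLeft (cand μ σ r H) s s)) (reward s s - cand μ σ r H s s)
    have h3 : 0 ≤ reward s s := le_max_right _ _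
    linarith
  · have hA : ∀ s, 0 < s → 0 ≤ coefA μ σ r H s := fun s hs =>
      (limA_nonneg hσ hr hm hH₀ h).trans (hH.limA_lt_coefA hσ hr hm hmn hH₀ hs).le
    exact ⟨fun x s hx hxs => hH.cand_pos hσ hr hm hmn hx (hx.trans_le hxs) (hA s (hx.trans_le hxs)),
      hH.solvesVI hσ hr hm hmn hA, hH.solvesNeumann hσ hr hm hmn⟩
  · intro Ω mΩ P _ ℱ W hW x s hx hxs
    have hpos : 0 < limA μ σ r Hinf * x ^ rootN μ σ r :=
      mul_pos (limA_pos hσ hr hm hH₀ h) (Real.rpow_pos_of_pos hx _)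
    refine ⟨hH.integrable_cand hσ hr hm hmn hH₀ h.le hW hx hxs, fun hT => ?_, fun τ hτ => ?_⟩
    · exact hpos.ne' (tendsto_nhds_unique
        (hH.tendsto_exp_mul_integral_cand hσ hr hm hmn hH₀ h.le hW hx hxs) hT)
    · obtain ⟨h1, h2⟩ := hH.tendsto_integral_discounted_cand hσ hr hm hmn hH₀ h.le hW hx hxs hτ
      exact ⟨h1, _, h2, le_rfl, hpos⟩
  · intro Ω mΩ P _ ℱ W hW x s hx hxs
    have h0 : limA μ σ r Hinf * x ^ rootN μ σ r = 0 := by rw [h, limA_crit hm, zero_mul]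
    refine ⟨hH.integrable_cand hσ hr hm hmn hH₀ h.le hW hx hxs, ?_, fun τ hτ => ?_⟩
    · have hT := hH.tendsto_exp_mul_integral_cand hσ hr hm hmn hH₀ h.le hW hx hxs
      rwa [h0] at hT
    · have hT := hH.tendsto_integral_discounted_cand hσ hr hm hmn hH₀ h.le hW hx hxs hτ
      rwa [h0] at hT
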